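/- For $n\ge 1$ let $USp(2n)$ be the compact group of unitary complex $2n\times 2n$ matrices $g$ with $gJg^{t}=J$, where $J=\begin{pmatrix}0&-1\\1&0\end{pmatrix}$ in $n\times n$ blocks. Endow it with the Riemannian distance $d_n$ of the bi-invariant metric $-\tfrac12\operatorname{Tr}(g^{-1}dg\otimes g^{-1}dg)$ and with the normalised invariant (Haar probability) measure $\mu_n$. Let $e$ be the $n$-th standard basis vector of $\mathbb C^{2n}$, let $\pi_n:USp(2n)\to S^{4n-1}\subset\mathbb C^{2n}=\mathbb R^{4n}$ be the orbit map $\pi_n(g)=ge$, and embed $USp(2n-2)$ in $USp(2n)$ by $A\mapsto\operatorname{diag}(A,1)$ with respect to the symplectic splitting $\mathbb C^{2n}=\mathbb C^{2n-2}\oplus\mathbb C^2$ in which $\mathbb C^2$ is spanned by the $n$-th and $2n$-th basis vectors. Then: 1. $\pi_n$ makes $USp(2n)$ a principal $USp(2n-2)$-fibration over $S^{4n-1}$: the embedding $USp(2n-2)\to USp(2n)$ is closed, $\pi_n$ induces a homeomorphism $USp(2n)/USp(2n-2)\cong S^{4n-1}$, and $\pi_n$ is locally trivial with fibre $USp(2n-2)$,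 by trivialisations equivariant for right multiplication by $USp(2n-2)$. 2. For every choice, for each $n\ge1$, of an equator $S_n$ of $S^{4n-1}$ (the intersection of $S^{4n-1}$ with a real hyperplane of $\mathbb R^{4n}$ through $0$), put $\Sigma_n=\pi_n^{-1}(S_n)$, the restriction of the fibration to $S_n$. Then $\Sigma_n$ is a smooth embedded submanifold of $USp(2n)$ of codimension one, and $\mu_n$ concentrates on $\Sigma_n$ as $n\to\infty$ in the following sense: each $(USp(2n),d_n)$ is a connected metric space (with its usual topology), open sets are measurable, nonempty open sets have nonzero measure, $\mu_n(USp(2n))=1$, $\Sigma_n$ is a proper closed subset, and there is a sequence $\varepsilon_n>0$ with $\varepsilon_n\to0$ such that $$\lim_{n\to\infty}\mu_n\bigl(USp(2n)\setminus U_n^{\varepsilon_n}\bigr)=0,\qquad U_n^{\varepsilon_n}=\{g\in USp(2n): d_n(g,s)<\varepsilon_n\text{ for some } s\in\Sigma_n\}.$$ -/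

import Mathlib

open MeasureTheory Filter Topology Set
open scoped ENNReal Matrix

namespace SymplecticConcentration

noncomputable section

/-! ### Concentration of measure on a family of subsets -/

/-- `d` is a (finite-valued) metric on `X` whose metric topology is the topology of `X`. -/
structure IsCompatibleMetric {X : Type*} [TopologicalSpace X] (d : X → X → ℝ≥0∞) : Prop where
  finite : ∀ x y, d x y ≠ ∞
  eq_zero_iff : ∀ x y, d x y = 0 ↔ x = y
  symm : ∀ x y, d x y = d y x
  triangle : ∀ x y z, d x z ≤ d x y + d y z
  isOpen_iff : ∀ U : Set X, IsOpen U ↔ ∀ x ∈ U, ∃ ε : ℝ, 0 < ε ∧ ∀ y, d x y < ENNReal.ofReal ε → y ∈ U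

/-- The tubular neighbourhood of radius `ε` of the set `S` with respect to the distance `d`. -/
def tube {X : Type*} (d : X → X → ℝ≥0∞) (S : Set X) (ε : ℝ) : Set X :=
  {x | ∃ s ∈ S, d x s < ENNReal.ofReal ε}

/-- Metric concentration: `(X n, d n, μ n)` is a sequence of connected metric spaces with normalised
measures for which open sets are measurable and nonempty ones have nonzero measure, the `S n` are
proper closed subsets, and there are radii `ε n > 0` tending to `0` such that the measure of the
complement of the tubular neighbourhood of `S n` of radius `ε n` tends to `0`. -/
structure ConcentratesOn (X : ℕ → Type*) [∀ n, TopologicalSpace (X n)]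
    [∀ n, MeasurableSpace (X n)] (d : ∀ n, X n → X n → ℝ≥0∞) (μ : ∀ n, Measure (X n))
    (S : ∀ n, Set (X n)) : Prop where
  connected : ∀ n, ConnectedSpace (X n)
  metric : ∀ n, IsCompatibleMetric (d n)
  measurable_of_isOpen : ∀ n (U : Set (X n)), IsOpen U → MeasurableSet U
  measure_ne_zero : ∀ n (U : Set (X n)), IsOpen U → U.Nonempty → μ n U ≠ 0
  normalized : ∀ n, μ n univ = 1
  isClosed : ∀ n, IsClosed (S n)
  proper : ∀ n, S n ≠ univ
  concentrates : ∃ ε : ℕ → ℝ, (∀ n, 0 < ε n) ∧ Tendsto ε atTop (𝓝 0) ∧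
    Tendsto (fun n => μ n (tube (d n) (S n) (ε n))ᶜ) atTop (𝓝 0)

/-! ### Fibrations and submanifolds -/

/-- `π : G → B` is a principal fibration with structure group (and fibre) `H`, where `H` is
identified by `ι` with a closed subgroup of `G` acting on `G` by right multiplication: the fibres of
`π` are the cosets `g ι(H)`, the induced map from `G / ι(H)` to `B` is a homeomorphism, and `π` is
locally trivial with fibre `H`, by trivialisations that are equivariant for the right action. -/
structure IsPrincipalFibration {G H B : Type*} [Group G] [TopologicalSpace G] [Group H]
    [TopologicalSpace H] [TopologicalSpace B] (π : G → B) (ι : H →* G) : Prop where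
  isClosedEmbedding : IsClosedEmbedding ι
  quotient : ∃ φ : (G ⧸ ι.range) ≃ₜ B, ∀ g : G, φ (g : G ⧸ ι.range) = π g
  locallyTrivial : ∀ b : B, ∃ e : Bundle.Trivialization H π, b ∈ e.baseSet ∧
    ∀ g ∈ e.source, ∀ h : H, (e (g * ι h)).2 = (e g).2 * h

/-- `M` is an embedded smooth submanifold of dimension `d` of the finite-dimensional real vector
space `V`: locally it is the zero set of a smooth map to `ℝ^(dim V - d)` with surjective derivative
along `M`. -/
def IsSmoothSubmanifold {V : Type*} [NormedAddCommGroup V] [NormedSpace ℝ V] (d : ℕ)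
    (M : Set V) : Prop :=
  ∃ k : ℕ, d + k = Module.finrank ℝ V ∧
    ∀ x ∈ M, ∃ (U : Set V) (f : V → (Fin k → ℝ)), IsOpen U ∧ x ∈ U ∧ ContDiffOn ℝ (⊤ : ℕ∞) f U ∧
      (∀ y ∈ U, y ∈ M ↔ f y = 0) ∧
      ∀ y ∈ U ∩ M, Function.Surjective (fderiv ℝ f y)

/-! ### The compact symplectic group -/

/-- `USp(2n)`: the unitary complex `2n × 2n` matrices that are symplectic. -/
def USp (n : ℕ) : Subgroup (Matrix.unitaryGroup (Fin n ⊕ Fin n) ℂ) where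
  carrier := {g | (g : Matrix (Fin n ⊕ Fin n) (Fin n ⊕ Fin n) ℂ) ∈ Matrix.symplecticGroup (Fin n) ℂ}
  mul_mem' {_ _} ha hb := (Matrix.symplecticGroup (Fin n) ℂ).mul_mem ha hb
  one_mem' := one_mem (Matrix.symplecticGroup (Fin n) ℂ)
  inv_mem' {a} ha := by
    have h1 : (a : Matrix (Fin n ⊕ Fin n) (Fin n ⊕ Fin n) ℂ) ∈ Matrix.symplecticGroup (Fin n) ℂ := ha
    have h2 := SymplecticGroup.map_mem (SymplecticGroup.transpose_mem h1) (starRingEnd ℂ)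
    exact h2

/-- The underlying matrix of an element of `USp(2n)`. -/
def USp.mat {n : ℕ} (g : USp n) : Matrix (Fin n ⊕ Fin n) (Fin n ⊕ Fin n) ℂ :=
  ((g : Matrix.unitaryGroup (Fin n ⊕ Fin n) ℂ) : Matrix (Fin n ⊕ Fin n) (Fin n ⊕ Fin n) ℂ)

theorem USp.continuous_mat {n : ℕ} : Continuous (USp.mat (n := n)) :=
  continuous_subtype_val.comp continuous_subtype_val

theorem USp.star_mul_self {n : ℕ} (g : USp n) : (USp.mat g)ᴴ * USp.mat g = 1 :=
  Matrix.mem_unitaryGroup_iff'.1 (g : Matrix.unitaryGroup (Fin n ⊕ Fin n) ℂ).2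

theorem USp.mem_symplectic {n : ℕ} (g : USp n) :
    USp.mat g * Matrix.J (Fin n) ℂ * (USp.mat g)ᵀ = Matrix.J (Fin n) ℂ :=
  SymplecticGroup.mem_iff.1 g.2

theorem USp.range_mat {n : ℕ} : range (USp.mat (n := n)) =
    {A | Aᴴ * A = 1} ∩ {A | A * Matrix.J (Fin n) ℂ * Aᵀ = Matrix.J (Fin n) ℂ} := by
  ext A
  constructor
  · rintro ⟨g, rfl⟩
    exact ⟨(USp.star_mul_self g), (USp.mem_symplectic g)⟩
  · rintro ⟨h1, h2⟩
    exact ⟨⟨⟨A, Matrix.mem_unitaryGroup_iff'.2 h1⟩, SymplecticGroup.mem_iff.2 h2⟩, rfl⟩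

theorem USp.isEmbedding_mat {n : ℕ} : IsEmbedding (USp.mat (n := n)) :=
  IsEmbedding.subtypeVal.comp IsEmbedding.subtypeVal

instance USp.instCompactSpace (n : ℕ) : CompactSpace (USp n) := by
  rw [← isCompact_univ_iff, USp.isEmbedding_mat.isCompact_iff, image_univ]
  have hsub : range (USp.mat (n := n)) ⊆
      univ.pi fun _ : Fin n ⊕ Fin n => univ.pi fun _ : Fin n ⊕ Fin n =>
        Metric.closedBall (0 : ℂ) 1 := by
    rintro _ ⟨g, rfl⟩ i - j -
    simpa [USp.mat] using entry_norm_bound_of_unitary (g : Matrix.unitaryGroup (Fin n ⊕ Fin n) ℂ).2 i j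
  refine IsCompact.of_isClosed_subset
    (isCompact_univ_pi fun _ => isCompact_univ_pi fun _ => isCompact_closedBall 0 1) ?_ hsub
  rw [USp.range_mat]
  refine IsClosed.inter (isClosed_eq (by fun_prop) (by fun_prop))
    (isClosed_eq (by fun_prop) (by fun_prop))

instance USp.instMeasurableSpace (n : ℕ) : MeasurableSpace (USp n) := borel _

instance USp.instBorelSpace (n : ℕ) : BorelSpace (USp n) := ⟨rfl⟩

/-- The normalised invariant (Haar probability) measure of `USp(2n)`. -/
def USp.invariantMeasure (n : ℕ) : Measure (USp n) := Measure.haarMeasure ⊤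

/-! ### The bi-invariant Riemannian metric -/

/-- The squared length of a tangent vector `X` of `USp(2n)` at `g` (seen as a matrix) for the
bi-invariant Riemannian metric `-½ Tr (g⁻¹dg ⊗ g⁻¹dg)`. -/
def USp.metricSq {n : ℕ} (g : USp n) (X : Matrix (Fin n ⊕ Fin n) (Fin n ⊕ Fin n) ℂ) : ℝ :=
  (-(1 / 2 : ℂ) * ((USp.mat g⁻¹ * X) * (USp.mat g⁻¹ * X)).trace).re

/-- The velocity matrix of a curve in `USp(2n)`. -/
def USp.velocity {n : ℕ} (γ : ℝ → USp n) (t : ℝ) : Matrix (Fin n ⊕ Fin n) (Fin n ⊕ Fin n) ℂ :=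
  Matrix.of fun i j => deriv (fun s => USp.mat (γ s) i j) t

/-- The curve `γ` in `USp(2n)` is continuously differentiable. -/
def USp.IsC1 {n : ℕ} (γ : ℝ → USp n) : Prop :=
  ∀ i j, ContDiff ℝ 1 fun t => USp.mat (γ t) i j

/-- The Riemannian length of `γ` on `[0, 1]`. -/
def USp.length {n : ℕ} (γ : ℝ → USp n) : ℝ :=
  ∫ t in (0 : ℝ)..1, Real.sqrt (USp.metricSq (γ t) (USp.velocity γ t))

/-- The Riemannian distance of the bi-invariant metric: the infimum of the lengths of the
continuously differentiable curves from `a` to `b`. (Curves are parametrised by `ℝ`; a curve on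
`[0, 1]` extends after a reparametrisation that makes it stationary near its end points.) -/
def USp.riemannianDist {n : ℕ} (a b : USp n) : ℝ≥0∞ :=
  ⨅ (γ : ℝ → USp n) (_ : USp.IsC1 γ ∧ γ 0 = a ∧ γ 1 = b), ENNReal.ofReal (USp.length γ)

/-- A set of elements of `USp(2n)` as a set in the real vector space of complex `2n × 2n` arrays. -/
def USp.matSet {n : ℕ} (S : Set (USp n)) : Set ((Fin n ⊕ Fin n) → (Fin n ⊕ Fin n) → ℂ) :=
  (fun g i j => USp.mat g i j) '' S

/-- `S` is a smooth embedded submanifold of `USp(2n)` of codimension `c`. -/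
def USp.IsSubmanifoldOfCodim {n : ℕ} (c : ℕ) (S : Set (USp n)) : Prop :=
  ∃ d : ℕ, IsSmoothSubmanifold (d + c) (USp.matSet (univ : Set (USp n))) ∧
    IsSmoothSubmanifold d (USp.matSet S)

/-! ### The fibration over the sphere -/

/-- The unit sphere `S^(4n-1)` of `ℂ^(2n) = ℝ^(4n)`. -/
abbrev UnitSphere (n : ℕ) : Type :=
  Metric.sphere (0 : EuclideanSpace ℂ (Fin n ⊕ Fin n)) 1

/-- The equator of the sphere that is orthogonal, for the real inner product of `ℂ^(2n) = ℝ^(4n)`,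
to the pole `u`. -/
def equator {n : ℕ} (u : UnitSphere n) : Set (UnitSphere n) :=
  {x | (inner ℂ (u : EuclideanSpace ℂ (Fin n ⊕ Fin n))
    (x : EuclideanSpace ℂ (Fin n ⊕ Fin n))).re = 0}

/-- The orbit map `g ↦ g e` from `USp(2n+2)` to `S^(4n+3)`, with `e` the last vector of the first
half of the standard basis. -/
def USp.proj (n : ℕ) (g : USp (n + 1)) : UnitSphere (n + 1) :=
  ⟨WithLp.toLp 2 (USp.mat g *ᵥ Pi.single (Sum.inl (Fin.last n)) 1), by
    rw [mem_sphere_zero_iff_norm, EuclideanSpace.norm_eq, Real.sqrt_eq_one]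
    have h := congrFun (congrFun (USp.star_mul_self g) (Sum.inl (Fin.last n))) (Sum.inl (Fin.last n))
    rw [Matrix.mul_apply, Matrix.one_apply_eq] at h
    have h' := congrArg Complex.re h
    rw [Complex.re_sum, Complex.one_re] at h'
    rw [← h']
    refine Finset.sum_congr rfl fun i _ => ?_
    simp [Matrix.conjTranspose_apply, ← Complex.normSq_eq_norm_sq, Complex.normSq_apply]⟩

/-- The index bijection that splits `ℂ^(2n+2)` as `ℂ^(2n) ⊕ ℂ^2`, compatibly with the symplectic
forms. -/
def splitIndex (n : ℕ) : (Fin n ⊕ Fin n) ⊕ (Fin 1 ⊕ Fin 1) ≃ Fin (n + 1) ⊕ Fin (n + 1) :=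
  (Equiv.sumSumSumComm (Fin n) (Fin n) (Fin 1) (Fin 1)).trans
    (Equiv.sumCongr finSumFinEquiv finSumFinEquiv)

/-- The block matrix `diag(A, 1)` with respect to `ℂ^(2n+2) = ℂ^(2n) ⊕ ℂ^2`. -/
def blockExtend {n : ℕ} (A : Matrix (Fin n ⊕ Fin n) (Fin n ⊕ Fin n) ℂ) :
    Matrix (Fin (n + 1) ⊕ Fin (n + 1)) (Fin (n + 1) ⊕ Fin (n + 1)) ℂ :=
  Matrix.reindex (splitIndex n) (splitIndex n) (Matrix.fromBlocks A 0 0 1)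

theorem blockExtend_mul {n : ℕ} (A B : Matrix (Fin n ⊕ Fin n) (Fin n ⊕ Fin n) ℂ) :
    blockExtend (A * B) = blockExtend A * blockExtend B := by
  simp [blockExtend, Matrix.submatrix_mul_equiv, Matrix.fromBlocks_multiply]

theorem blockExtend_one {n : ℕ} :
    blockExtend (1 : Matrix (Fin n ⊕ Fin n) (Fin n ⊕ Fin n) ℂ) = 1 := by
  simp [blockExtend]

theorem blockExtend_conjTranspose {n : ℕ} (A : Matrix (Fin n ⊕ Fin n) (Fin n ⊕ Fin n) ℂ) :
    (blockExtend A)ᴴ = blockExtend Aᴴ := by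
  simp [blockExtend, Matrix.conjTranspose_submatrix, Matrix.fromBlocks_conjTranspose]

theorem blockExtend_transpose {n : ℕ} (A : Matrix (Fin n ⊕ Fin n) (Fin n ⊕ Fin n) ℂ) :
    (blockExtend A)ᵀ = blockExtend Aᵀ := by
  simp [blockExtend, Matrix.transpose_submatrix, Matrix.fromBlocks_transpose]

theorem J_eq_reindex (n : ℕ) : Matrix.J (Fin (n + 1)) ℂ =
    Matrix.reindex (splitIndex n) (splitIndex n)
      (Matrix.fromBlocks (Matrix.J (Fin n) ℂ) 0 0 (Matrix.J (Fin 1) ℂ)) := by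
  rw [← Equiv.symm_apply_eq]
  ext i j
  rcases i with (i | i) | (i | i) <;> rcases j with (j | j) | (j | j) <;>
    simp [Matrix.J, splitIndex, Equiv.sumSumSumComm, Matrix.one_apply, Fin.ext_iff] <;> omega

theorem blockExtend_symplectic {n : ℕ} {A : Matrix (Fin n ⊕ Fin n) (Fin n ⊕ Fin n) ℂ}
    (hA : A * Matrix.J (Fin n) ℂ * Aᵀ = Matrix.J (Fin n) ℂ) :
    blockExtend A * Matrix.J (Fin (n + 1)) ℂ * (blockExtend A)ᵀ = Matrix.J (Fin (n + 1)) ℂ := by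
  rw [blockExtend_transpose, J_eq_reindex]
  simp [blockExtend, Matrix.submatrix_mul_equiv, Matrix.fromBlocks_multiply, hA]

/-- The standard embedding `A ↦ diag(A, 1)` of `USp(2n)` in `USp(2n+2)`. -/
def USp.incl (n : ℕ) : USp n →* USp (n + 1) where
  toFun g := ⟨⟨blockExtend (USp.mat g), Matrix.mem_unitaryGroup_iff'.2 (by
      rw [Matrix.star_eq_conjTranspose, blockExtend_conjTranspose, ← blockExtend_mul,
        (USp.star_mul_self g), blockExtend_one])⟩,
    SymplecticGroup.mem_iff.2 (blockExtend_symplectic (USp.mem_symplectic g))⟩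
  map_one' := Subtype.ext (Subtype.ext blockExtend_one)
  map_mul' a b := Subtype.ext (Subtype.ext (blockExtend_mul (USp.mat a) (USp.mat b)))

/-- The part of `USp(2n+2)` lying over the equator of `S^(4n+3)` with pole `u`. -/
def USp.overEquator {n : ℕ} (u : UnitSphere (n + 1)) : Set (USp (n + 1)) :=
  USp.proj n ⁻¹' equator u

end

end SymplecticConcentration

open SymplecticConcentration

/-! For a unitary g the condition gJgᵗ = J says gJ = Jḡ, so `USp n` is the unitary group of
n-dimensional quaternionic space. Quaternions are handled as complex 2 × 2 matrices, and a vector x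
as its quaternionic column [x, Jx̄] (`quatCols`), whose Gram matrix is |x|² times the identity.

Fibration. For unit vectors x ≠ y a quasi-reflection 1 − W B Wᴴ, with W the column of x − y and B a
suitable quaternion, is unitary and maps x to y (`transport`). This gives transitivity and, by
continuity in y, local sections of the orbit map. The stabiliser of e is the block subgroup
(`USp.exists_incl_of_mulVec_lastVec`), and compactness turns the bijection from the quotient into a
homeomorphism. Deforming B joins 1 to the quasi-reflection by a C¹ curve, whence connectedness by
induction on n.

Distance. The Riemannian speed is the Frobenius speed divided by √2. Integrating it bounds matrix
entries by the distance; conversely Cayley curves join nearby points by short paths. So the distance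
is compatible with the topology.

Hypersurface. The group is a regular zero set in the space of matrices. The height Re⟨u, ge⟩ is an
independent equation where it vanishes, because the infinitesimal rotation of e towards gᴴu changes
it to first order.

Concentration. Let ρ(g) be the squared norm of the quaternionic product of u and ge. By invariance
and transitivity its mean on `USp (n + 1)` is 1/(n+1) (`USp.integral_quatNormSq_quatCoeff`). If ρ(g)
≤ 1/2, a Cayley rotation moves g into the hypersurface over a distance at most 4√ρ(g)
(`USp.exists_mem_overEquator_riemannianDist_le`). Markov's inequality bounds the measure outside the
tube of radius 4√c by 1/((n+1)c), and c of order (n+1)^(-1/2) makes both tend to 0. The bounds do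
not depend on u, so the equators may vary freely with n. -/

namespace SymplecticConcentration

/-! ### Quaternionic matrices -/

section Quaternionic

set_option linter.unusedSectionVars false

variable {l m k : Type*} [Fintype l] [DecidableEq l] [Fintype m] [DecidableEq m]
  [Fintype k] [DecidableEq k]

/-- A complex matrix that commutes with the quaternionic structures `v ↦ J v̄`. -/
def IsQuat (M : Matrix (l ⊕ l) (m ⊕ m) ℂ) : Prop :=
  M * Matrix.J m ℂ = Matrix.J l ℂ * M.map (starRingEnd ℂ)

theorem conjTranspose_eq_transpose_map {p q : Type*} (M : Matrix p q ℂ) :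
    Mᴴ = (M.map (starRingEnd ℂ))ᵀ := rfl

theorem J_conjTranspose : (Matrix.J l ℂ)ᴴ = -Matrix.J l ℂ := by
  rw [conjTranspose_eq_transpose_map, Matrix.map_J, Matrix.J_transpose]

theorem map_conj_map_conj {p q : Type*} (M : Matrix p q ℂ) :
    (M.map (starRingEnd ℂ)).map (starRingEnd ℂ) = M := by
  ext i j; simp

namespace IsQuat

theorem mul {M : Matrix (l ⊕ l) (m ⊕ m) ℂ} {N : Matrix (m ⊕ m) (k ⊕ k) ℂ}
    (hM : IsQuat M) (hN : IsQuat N) : IsQuat (M * N) := by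
  unfold IsQuat at *
  rw [Matrix.map_mul, Matrix.mul_assoc, hN, ← Matrix.mul_assoc, hM, Matrix.mul_assoc]

theorem one : IsQuat (1 : Matrix (l ⊕ l) (l ⊕ l) ℂ) := by
  simp [IsQuat, Matrix.map_one]

theorem add {M N : Matrix (l ⊕ l) (m ⊕ m) ℂ} (hM : IsQuat M) (hN : IsQuat N) :
    IsQuat (M + N) := by
  unfold IsQuat at *
  rw [Matrix.map_add _ (map_add _), Matrix.add_mul, Matrix.mul_add, hM, hN]

theorem sub {M N : Matrix (l ⊕ l) (m ⊕ m) ℂ} (hM : IsQuat M) (hN : IsQuat N) :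
    IsQuat (M - N) := by
  unfold IsQuat at *
  rw [Matrix.map_sub _ (map_sub _), Matrix.sub_mul, Matrix.mul_sub, hM, hN]

theorem smul {M : Matrix (l ⊕ l) (m ⊕ m) ℂ} (hM : IsQuat M) (r : ℝ) : IsQuat (r • M) := by
  unfold IsQuat at *
  have : (r • M).map (starRingEnd ℂ) = r • M.map (starRingEnd ℂ) := by
    ext i j; simp
  rw [this, Matrix.smul_mul, Matrix.mul_smul, hM]

theorem conjTranspose {M : Matrix (l ⊕ l) (m ⊕ m) ℂ} (hM : IsQuat M) : IsQuat Mᴴ := by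
  unfold IsQuat at *
  have h := congrArg (fun A : Matrix (l ⊕ l) (m ⊕ m) ℂ => Aᵀ) hM
  simp only [Matrix.transpose_mul, Matrix.J_transpose, ← conjTranspose_eq_transpose_map,
    Matrix.neg_mul, Matrix.mul_neg, neg_inj] at h
  rw [← h]
  congr 1
  ext i j
  simp

theorem inv {M : Matrix (l ⊕ l) (l ⊕ l) ℂ} (hM : IsQuat M) (hdet : IsUnit M.det) :
    IsQuat M⁻¹ := by
  have h1 : M⁻¹ * M = 1 := Matrix.nonsing_inv_mul M hdet
  have h3 : M.map (starRingEnd ℂ) * M⁻¹.map (starRingEnd ℂ) = 1 := by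
    rw [← Matrix.map_mul, Matrix.mul_nonsing_inv M hdet, Matrix.map_one _ (map_zero _) (map_one _)]
  unfold IsQuat at *
  calc M⁻¹ * Matrix.J l ℂ
      = M⁻¹ * (Matrix.J l ℂ * M.map (starRingEnd ℂ)) * M⁻¹.map (starRingEnd ℂ) := by
        rw [Matrix.mul_assoc, Matrix.mul_assoc, h3, Matrix.mul_one]
    _ = Matrix.J l ℂ * M⁻¹.map (starRingEnd ℂ) := by
        rw [← hM, ← Matrix.mul_assoc, h1, Matrix.one_mul]

end IsQuat

/-- The quaternionic column `[x, J x̄]` generated by the vector `x`. -/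
def quatCols (x : l ⊕ l → ℂ) : Matrix (l ⊕ l) (Fin 1 ⊕ Fin 1) ℂ :=
  Matrix.of fun i j => Sum.elim (fun _ => x i) (fun _ => (Matrix.J l ℂ *ᵥ star x) i) j

theorem J_mulVec (x : l ⊕ l → ℂ) :
    Matrix.J l ℂ *ᵥ x = Sum.elim (fun i => -x (Sum.inr i)) (fun i => x (Sum.inl i)) := by
  have hx : x = Sum.elim (x ∘ Sum.inl) (x ∘ Sum.inr) := (Sum.elim_comp_inl_inr x).symm
  conv_lhs => rw [hx]
  rw [Matrix.J, Matrix.fromBlocks_mulVec]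
  ext i
  rcases i with i | i <;> simp [Matrix.neg_mulVec]

/-- The map x ↦ Jx̄ squares to −1, so both sides have the columns Jx̄ and −x. -/
theorem isQuat_quatCols (x : l ⊕ l → ℂ) : IsQuat (quatCols x) := by
  unfold IsQuat
  ext i j
  have hR : (Matrix.J l ℂ * (quatCols x).map (starRingEnd ℂ)) i j =
      (Matrix.J l ℂ *ᵥ (fun i => starRingEnd ℂ (quatCols x i j))) i := rfl
  have hL : (quatCols x * Matrix.J (Fin 1) ℂ) i j =
      Sum.elim (fun _ => quatCols x i (Sum.inr 0)) (fun _ => -quatCols x i (Sum.inl 0)) j := by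
    rw [Matrix.mul_apply, Fintype.sum_sum_type]
    rcases j with j | j <;> simp [Matrix.J, Subsingleton.elim j 0]
  rw [hR, hL]
  rcases i with i | i <;> rcases j with j | j <;> simp [J_mulVec, quatCols]

/-- Commutation with the quaternionic structure expresses the second column through the first. Hence
identities between such matrices need only be checked on first columns, and they all arise from
vectors. -/
theorem IsQuat.eq_quatCols {K : Matrix (l ⊕ l) (Fin 1 ⊕ Fin 1) ℂ} (hK : IsQuat K) :
    K = quatCols (fun i => K i (Sum.inl 0)) := by
  ext i j
  rcases j with j | j
  · simp [quatCols, Subsingleton.elim j 0]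
  · have h := congrFun (congrFun hK i) (Sum.inl 0)
    rw [Matrix.mul_apply, Fintype.sum_sum_type] at h
    simp only [Matrix.J, Finset.univ_unique, Fin.default_eq_zero, Fin.isValue, Finset.sum_singleton,
      Matrix.fromBlocks_apply₁₁, Matrix.zero_apply, mul_zero, Matrix.fromBlocks_apply₂₁,
      Matrix.one_apply_eq, mul_one, zero_add] at h
    rw [Subsingleton.elim j 0, h]
    rfl

theorem IsQuat.mul_quatCols {M : Matrix (l ⊕ l) (m ⊕ m) ℂ} (hM : IsQuat M) (x : m ⊕ m → ℂ) :
    M * quatCols x = quatCols (M *ᵥ x) := by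
  rw [(hM.mul (isQuat_quatCols x)).eq_quatCols]
  rfl

theorem quatCols_sub (x y : l ⊕ l → ℂ) : quatCols (x - y) = quatCols x - quatCols y := by
  ext i j
  rcases j with j | j <;> simp [quatCols, Matrix.mulVec_sub]

theorem quatCols_injective : Function.Injective (quatCols (l := l)) := fun x y h => by
  ext i
  exact congrFun (congrFun h i) (Sum.inl 0)

/-! ### Quaternion norms, Gram matrices and quasi-reflections -/

/-- The squared norm of a quaternion, written as a complex `2 × 2` matrix. -/
noncomputable def quatNormSq (K : Matrix (Fin 1 ⊕ Fin 1) (Fin 1 ⊕ Fin 1) ℂ) : ℝ :=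
  Complex.normSq (K (Sum.inl 0) (Sum.inl 0)) + Complex.normSq (K (Sum.inr 0) (Sum.inl 0))

theorem IsQuat.inr_inl {K : Matrix (Fin 1 ⊕ Fin 1) (Fin 1 ⊕ Fin 1) ℂ} (hK : IsQuat K) :
    K (Sum.inl 0) (Sum.inr 0) = -starRingEnd ℂ (K (Sum.inr 0) (Sum.inl 0)) := by
  rw [hK.eq_quatCols]; simp [quatCols, J_mulVec]

theorem IsQuat.inr_inr {K : Matrix (Fin 1 ⊕ Fin 1) (Fin 1 ⊕ Fin 1) ℂ} (hK : IsQuat K) :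
    K (Sum.inr 0) (Sum.inr 0) = starRingEnd ℂ (K (Sum.inl 0) (Sum.inl 0)) := by
  rw [hK.eq_quatCols]; simp [quatCols, J_mulVec]

theorem IsQuat.conjTranspose_mul_self {K : Matrix (Fin 1 ⊕ Fin 1) (Fin 1 ⊕ Fin 1) ℂ}
    (hK : IsQuat K) : Kᴴ * K = quatNormSq K • (1 : Matrix (Fin 1 ⊕ Fin 1) (Fin 1 ⊕ Fin 1) ℂ) := by
  ext i j
  rcases i with i | i <;> rcases j with j | j <;>
    simp [Subsingleton.elim i 0, Subsingleton.elim j 0, Matrix.mul_apply,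
      hK.inr_inr, hK.inr_inl, quatNormSq, Complex.normSq_eq_conj_mul_self] <;> ring

theorem IsQuat.mul_conjTranspose_self {K : Matrix (Fin 1 ⊕ Fin 1) (Fin 1 ⊕ Fin 1) ℂ}
    (hK : IsQuat K) : K * Kᴴ = quatNormSq K • (1 : Matrix (Fin 1 ⊕ Fin 1) (Fin 1 ⊕ Fin 1) ℂ) := by
  ext i j
  rcases i with i | i <;> rcases j with j | j <;>
    simp [Subsingleton.elim i 0, Subsingleton.elim j 0, Matrix.mul_apply,
      hK.inr_inr, hK.inr_inl, quatNormSq, Complex.normSq_eq_conj_mul_self] <;> ring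

open ComplexOrder in
theorem IsQuat.quatNormSq_ne_zero {K : Matrix (Fin 1 ⊕ Fin 1) (Fin 1 ⊕ Fin 1) ℂ}
    (hK : IsQuat K) (h0 : K ≠ 0) : quatNormSq K ≠ 0 := fun h => h0 <| by
  have h1 := hK.conjTranspose_mul_self
  rw [h, zero_smul] at h1
  exact Matrix.conjTranspose_mul_self_eq_zero.1 h1

/-- The squared hermitian norm of a complex vector. -/
noncomputable def vecNormSq {p : Type*} [Fintype p] (x : p → ℂ) : ℝ := ∑ i, Complex.normSq (x i)

theorem star_dotProduct_self {p : Type*} [Fintype p] (x : p → ℂ) :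
    star x ⬝ᵥ x = (vecNormSq x : ℂ) := by
  simp [dotProduct, vecNormSq, Complex.normSq_eq_conj_mul_self]

theorem vecNormSq_eq_zero {p : Type*} [Fintype p] {x : p → ℂ} : vecNormSq x = 0 ↔ x = 0 := by
  unfold vecNormSq
  rw [Finset.sum_eq_zero_iff_of_nonneg fun i _ => Complex.normSq_nonneg _]
  simp [funext_iff]

/-- The off-diagonal entry pairs x with itself under the alternating form J, hence vanishes; the
remaining entries follow because the Gram matrix is itself quaternionic. -/
theorem quatCols_gram (x : l ⊕ l → ℂ) :
    (quatCols x)ᴴ * quatCols x =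
      vecNormSq x • (1 : Matrix (Fin 1 ⊕ Fin 1) (Fin 1 ⊕ Fin 1) ℂ) := by
  have hq := (isQuat_quatCols x).conjTranspose.mul (isQuat_quatCols x)
  have h00 : ((quatCols x)ᴴ * quatCols x) (Sum.inl 0) (Sum.inl 0) = (vecNormSq x : ℂ) :=
    star_dotProduct_self x
  have h10 : ((quatCols x)ᴴ * quatCols x) (Sum.inr 0) (Sum.inl 0) = 0 := by
    rw [Matrix.mul_apply, Fintype.sum_sum_type]
    simp [quatCols, J_mulVec, mul_comm]
  have h01 := hq.inr_inl
  have h11 := hq.inr_inr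
  rw [h10] at h01
  rw [h00] at h11
  ext i j
  rcases i with i | i <;> rcases j with j | j <;>
    simp only [Subsingleton.elim i 0, Subsingleton.elim j 0, h00, h10, h01, h11] <;> simp

/-- The quaternionic unit `i` as a complex `2 × 2` matrix. -/
def quatI : Matrix (Fin 1 ⊕ Fin 1) (Fin 1 ⊕ Fin 1) ℂ :=
  Matrix.fromBlocks (Complex.I • 1) 0 0 (-(Complex.I • 1))

theorem isQuat_quatI : IsQuat quatI := by
  unfold IsQuat
  simp only [quatI, Matrix.J, Matrix.fromBlocks_map, Matrix.fromBlocks_multiply]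
  congr 1 <;> ext i j <;> simp [Subsingleton.elim i j]

theorem quatI_conjTranspose : quatIᴴ = -quatI := by
  simp [quatI, Matrix.fromBlocks_conjTranspose, Matrix.fromBlocks_neg]

theorem quatI_ne_zero : quatI ≠ 0 := fun h => by
  simpa [quatI] using congrFun (congrFun h (Sum.inl 0)) (Sum.inl 0)

/-- Quaternionic quasi-reflections `1 - W B Wᴴ` are unitary. -/
theorem quasiReflection_unitary {W : Matrix (l ⊕ l) (Fin 1 ⊕ Fin 1) ℂ}
    {A : Matrix (Fin 1 ⊕ Fin 1) (Fin 1 ⊕ Fin 1) ℂ} {r t : ℝ} (hA : IsQuat A) (hA0 : A ≠ 0)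
    (hW : Wᴴ * W = r • (1 : Matrix (Fin 1 ⊕ Fin 1) (Fin 1 ⊕ Fin 1) ℂ))
    (hr : A + Aᴴ = (t * r) • (1 : Matrix (Fin 1 ⊕ Fin 1) (Fin 1 ⊕ Fin 1) ℂ)) :
    (1 - (t / quatNormSq A) • (W * Aᴴ * Wᴴ))ᴴ * (1 - (t / quatNormSq A) • (W * Aᴴ * Wᴴ)) = 1 := by
  have hν := hA.quatNormSq_ne_zero hA0
  have hAA := hA.mul_conjTranspose_self
  set ν := quatNormSq A
  set c := t / ν with hc
  have hconj : (1 - c • (W * Aᴴ * Wᴴ))ᴴ = 1 - c • (W * A * Wᴴ) := by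
    simp [Matrix.conjTranspose_smul, Matrix.mul_assoc]
  have h1 : (W * A * Wᴴ) * (W * Aᴴ * Wᴴ) = (r * ν) • (W * Wᴴ) := by
    calc (W * A * Wᴴ) * (W * Aᴴ * Wᴴ) = W * A * (Wᴴ * W) * Aᴴ * Wᴴ := by
          simp only [Matrix.mul_assoc]
      _ = r • (W * (A * Aᴴ) * Wᴴ) := by
          rw [hW]; simp only [Matrix.mul_smul, Matrix.smul_mul, Matrix.mul_one, Matrix.mul_assoc]
      _ = (r * ν) • (W * Wᴴ) := by
          rw [hAA]; simp only [Matrix.mul_smul, Matrix.smul_mul, Matrix.mul_one, smul_smul]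
  have h2 : W * A * Wᴴ + W * Aᴴ * Wᴴ = (t * r) • (W * Wᴴ) := by
    rw [← Matrix.add_mul, ← Matrix.mul_add, hr]
    simp only [Matrix.mul_smul, Matrix.smul_mul, Matrix.mul_one]
  -- The choice c = t/ν is the one for which the linear and quadratic terms in c cancel.
  have h3 : c * (t * r) = c * c * (r * ν) := by rw [hc]; field_simp
  calc (1 - c • (W * Aᴴ * Wᴴ))ᴴ * (1 - c • (W * Aᴴ * Wᴴ))
      = 1 - c • (W * A * Wᴴ + W * Aᴴ * Wᴴ) + (c * c) • ((W * A * Wᴴ) * (W * Aᴴ * Wᴴ)) := by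
        rw [hconj]
        simp only [Matrix.sub_mul, Matrix.mul_sub, Matrix.one_mul, Matrix.mul_one, Matrix.smul_mul,
          Matrix.mul_smul, smul_smul, smul_add, smul_sub]
        abel
    _ = 1 := by
        rw [h1, h2, smul_smul, smul_smul, h3]; abel

end Quaternionic

/-! ### Elements of the compact symplectic group -/

/-- Unitarity gives gᵗḡ = 1; multiplying gJgᵗ = J on the right by ḡ yields gJ = Jḡ. -/
theorem USp.isQuat {n : ℕ} (g : USp n) : IsQuat (USp.mat g) := by
  have h1 : USp.mat g * (USp.mat g)ᴴ = 1 := mul_eq_one_comm.1 (USp.star_mul_self g)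
  have h2 : (USp.mat g)ᵀ * (USp.mat g).map (starRingEnd ℂ) = 1 := by
    have h := congrArg (fun A : Matrix (Fin n ⊕ Fin n) (Fin n ⊕ Fin n) ℂ => Aᵀ)
      (USp.star_mul_self g)
    simpa [conjTranspose_eq_transpose_map] using h
  unfold IsQuat
  conv_rhs => rw [← USp.mem_symplectic g]
  rw [Matrix.mul_assoc, h2, Matrix.mul_one]

/-- A unitary quaternionic matrix as an element of `USp(2n)`. -/
def USp.mk {n : ℕ} (M : Matrix (Fin n ⊕ Fin n) (Fin n ⊕ Fin n) ℂ) (h : Mᴴ * M = 1)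
    (hM : IsQuat M) : USp n :=
  ⟨⟨M, Matrix.mem_unitaryGroup_iff'.2 h⟩, SymplecticGroup.mem_iff.2 (by
    have h1 : M * Mᴴ = 1 := mul_eq_one_comm.1 h
    have h2 : M.map (starRingEnd ℂ) * Mᵀ = 1 := by
      have h := congrArg (fun A : Matrix (Fin n ⊕ Fin n) (Fin n ⊕ Fin n) ℂ => Aᵀ) h1
      simpa [conjTranspose_eq_transpose_map] using h
    change M * Matrix.J (Fin n) ℂ * Mᵀ = _
    rw [hM, Matrix.mul_assoc, h2, Matrix.mul_one])⟩

@[simp] theorem USp.mat_mk {n : ℕ} (M : Matrix (Fin n ⊕ Fin n) (Fin n ⊕ Fin n) ℂ) (h : Mᴴ * M = 1)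
    (hM : IsQuat M) : USp.mat (USp.mk M h hM) = M := rfl

theorem USp.mat_mul {n : ℕ} (a b : USp n) : USp.mat (a * b) = USp.mat a * USp.mat b := rfl

theorem USp.mat_one {n : ℕ} : USp.mat (1 : USp n) = 1 := rfl

theorem USp.mat_inv {n : ℕ} (a : USp n) : USp.mat a⁻¹ = (USp.mat a)ᴴ := rfl

theorem USp.mat_injective {n : ℕ} : Function.Injective (USp.mat (n := n)) :=
  USp.isEmbedding_mat.injective

theorem USp.mul_star_self {n : ℕ} (g : USp n) : USp.mat g * (USp.mat g)ᴴ = 1 :=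
  mul_eq_one_comm.1 (USp.star_mul_self g)

theorem USp.continuous_iff {n : ℕ} {X : Type*} [TopologicalSpace X] {f : X → USp n} :
    Continuous f ↔ Continuous fun x => USp.mat (f x) :=
  USp.isEmbedding_mat.continuous_iff

/-! ### Quasi-reflections moving a unit vector to another one -/

section Transport

variable {l : Type*} [Fintype l] [DecidableEq l]

/-- The quaternion `1 - ⟨y, x⟩`, deformed to the unit `i` as `t` goes from `1` to `0`. -/
noncomputable def transportQuat (x y : l ⊕ l → ℂ) (t : ℝ) :
    Matrix (Fin 1 ⊕ Fin 1) (Fin 1 ⊕ Fin 1) ℂ :=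
  t • (1 - (quatCols y)ᴴ * quatCols x) + (1 - t) • quatI

/-- A curve of unitary quaternionic matrices from `1` to a quasi-reflection that maps the unit
vector `x` to the unit vector `y`. -/
noncomputable def transport (x y : l ⊕ l → ℂ) (t : ℝ) : Matrix (l ⊕ l) (l ⊕ l) ℂ :=
  1 - (t / quatNormSq (transportQuat x y t)) •
    (quatCols (x - y) * (transportQuat x y t)ᴴ * (quatCols (x - y))ᴴ)

theorem isQuat_transportQuat (x y : l ⊕ l → ℂ) (t : ℝ) : IsQuat (transportQuat x y t) :=
  ((IsQuat.one.sub ((isQuat_quatCols y).conjTranspose.mul (isQuat_quatCols x))).smul t).add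
    (isQuat_quatI.smul _)

theorem isQuat_transport (x y : l ⊕ l → ℂ) (t : ℝ) : IsQuat (transport x y t) :=
  IsQuat.one.sub ((((isQuat_quatCols _).mul (isQuat_transportQuat x y t).conjTranspose).mul
    (isQuat_quatCols _).conjTranspose).smul _)

variable {x y : l ⊕ l → ℂ}

/-- The unit i is skew and drops out, while (1 − q) + (1 − q)ᴴ = |x − y|² for q = ⟨y, x⟩. This is
the hypothesis that `quasiReflection_unitary` needs. -/
theorem transportQuat_add_conjTranspose (hx : vecNormSq x = 1) (hy : vecNormSq y = 1) (t : ℝ) :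
    transportQuat x y t + (transportQuat x y t)ᴴ =
      (t * vecNormSq (x - y)) • (1 : Matrix (Fin 1 ⊕ Fin 1) (Fin 1 ⊕ Fin 1) ℂ) := by
  rw [mul_smul, ← quatCols_gram, quatCols_sub]
  simp only [transportQuat, Matrix.conjTranspose_add, Matrix.conjTranspose_smul,
    Matrix.conjTranspose_sub, Matrix.conjTranspose_mul, Matrix.conjTranspose_conjTranspose,
    Matrix.conjTranspose_one, quatI_conjTranspose, Matrix.sub_mul, Matrix.mul_sub, quatCols_gram,
    hx, hy, one_smul, star_trivial, smul_neg, smul_sub]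
  abel

/-- The hermitian part is positive multiples of t, so vanishing forces t = 0, where the quaternion
is i. This is why i was added: the coefficient stays regular at t = 0 and the curve really starts at
1. -/
theorem transportQuat_ne_zero (hx : vecNormSq x = 1) (hy : vecNormSq y = 1) (hxy : x ≠ y) (t : ℝ) :
    transportQuat x y t ≠ 0 := by
  intro h
  have h1 := transportQuat_add_conjTranspose hx hy t
  rw [h, Matrix.conjTranspose_zero, add_zero] at h1
  have h2 : t * vecNormSq (x - y) = 0 := by
    simpa using (congrFun (congrFun h1 (Sum.inl 0)) (Sum.inl 0)).symm
  have h3 : vecNormSq (x - y) ≠ 0 := fun h3 => hxy (sub_eq_zero.1 (vecNormSq_eq_zero.1 h3))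
  have h4 : t = 0 := (mul_eq_zero.1 h2).resolve_right h3
  subst h4
  exact quatI_ne_zero (by simpa [transportQuat] using h)

theorem transport_unitary (hx : vecNormSq x = 1) (hy : vecNormSq y = 1) (hxy : x ≠ y) (t : ℝ) :
    (transport x y t)ᴴ * transport x y t = 1 :=
  quasiReflection_unitary (isQuat_transportQuat x y t) (transportQuat_ne_zero hx hy hxy t)
    (quatCols_gram _) (transportQuat_add_conjTranspose hx hy t)

theorem transport_zero : transport x y 0 = 1 := by simp [transport]

/-- With W = x − y, the quaternion Wᴴx = 1 − ⟨y, x⟩ is exactly A = `transportQuat x y 1`. Thus W Aᴴ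
Wᴴ x / |A|² = W, and x − W = y. -/
theorem transport_mulVec (hx : vecNormSq x = 1) (hy : vecNormSq y = 1) (hxy : x ≠ y) :
    transport x y 1 *ᵥ x = y := by
  apply quatCols_injective
  rw [← (isQuat_transport x y 1).mul_quatCols]
  have hA := (isQuat_transportQuat x y 1)
  have h1 : (quatCols (x - y))ᴴ * quatCols x = transportQuat x y 1 := by
    simp [transportQuat, quatCols_sub, Matrix.sub_mul, quatCols_gram, hx]
  rw [transport, Matrix.sub_mul, Matrix.smul_mul, Matrix.mul_assoc, h1, Matrix.mul_assoc,
    hA.conjTranspose_mul_self, Matrix.mul_smul, smul_smul, Matrix.mul_one, Matrix.one_mul,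
    div_mul_cancel₀ _ (hA.quatNormSq_ne_zero (transportQuat_ne_zero hx hy hxy 1)), one_smul,
    quatCols_sub]
  abel

theorem contDiff_transport (hx : vecNormSq x = 1) (hy : vecNormSq y = 1) (hxy : x ≠ y)
    (i j : l ⊕ l) : ContDiff ℝ 1 fun t => transport x y t i j := by
  set A := 1 - (quatCols y)ᴴ * quatCols x with hA
  set W := quatCols (x - y) with hW
  have hν : ContDiff ℝ 1 fun t => quatNormSq (transportQuat x y t) := by
    simp only [quatNormSq, transportQuat, Complex.normSq_apply, ← hA, Matrix.add_apply,
      Matrix.smul_apply, Complex.add_re, Complex.add_im, Complex.smul_re, Complex.smul_im]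
    fun_prop
  have h0 : ∀ t, quatNormSq (transportQuat x y t) ≠ 0 := fun t =>
    (isQuat_transportQuat x y t).quatNormSq_ne_zero (transportQuat_ne_zero hx hy hxy t)
  have h : ∀ t, transport x y t i j = (1 : Matrix (l ⊕ l) (l ⊕ l) ℂ) i j -
      (t / quatNormSq (transportQuat x y t)) • (t • (W * Aᴴ * Wᴴ) i j +
        (1 - t) • (W * quatIᴴ * Wᴴ) i j) := by
    intro t
    rw [transport, ← hW]
    have h1 : W * (transportQuat x y t)ᴴ * Wᴴ =
        t • (W * Aᴴ * Wᴴ) + (1 - t) • (W * quatIᴴ * Wᴴ) := by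
      simp only [transportQuat, ← hA, Matrix.conjTranspose_add, Matrix.conjTranspose_smul,
        star_trivial, Matrix.mul_add, Matrix.add_mul, Matrix.mul_smul, Matrix.smul_mul]
    rw [h1]
    rfl
  simp only [h]
  exact contDiff_const.sub ((contDiff_id.div hν h0).smul (by fun_prop))

theorem continuousOn_transport (hx : vecNormSq x = 1) :
    ContinuousOn (fun y => transport x y 1) {y | vecNormSq y = 1 ∧ y ≠ x} := by
  have hc : Continuous fun y : l ⊕ l → ℂ => quatCols y := by
    refine continuous_matrix fun i j => ?_
    rcases j with j | j <;> rcases i with i | i <;> simp only [quatCols, Matrix.of_apply,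
      Sum.elim_inl, Sum.elim_inr, J_mulVec, Pi.star_apply] <;> fun_prop
  have hd : Continuous fun y : l ⊕ l → ℂ => quatCols (x - y) :=
    hc.comp (continuous_const.sub continuous_id)
  have hA : Continuous fun y : l ⊕ l → ℂ => transportQuat x y 1 := by
    unfold transportQuat
    fun_prop
  have hν : Continuous fun y : l ⊕ l → ℂ => quatNormSq (transportQuat x y 1) := by
    unfold quatNormSq
    exact (Complex.continuous_normSq.comp (hA.matrix_elem _ _)).add
      (Complex.continuous_normSq.comp (hA.matrix_elem _ _))
  unfold transport
  refine continuousOn_const.sub (ContinuousOn.fun_smul ?_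
    ((hd.matrix_mul hA.matrix_conjTranspose).matrix_mul hd.matrix_conjTranspose).continuousOn)
  exact continuousOn_const.div hν.continuousOn fun y hy =>
    (isQuat_transportQuat x y 1).quatNormSq_ne_zero (transportQuat_ne_zero hx hy.1 hy.2.symm 1)

end Transport

/-! ### The fibration over the sphere -/

theorem UnitSphere.vecNormSq_ofLp {n : ℕ} (x : UnitSphere n) :
    vecNormSq (x : EuclideanSpace ℂ (Fin n ⊕ Fin n)).ofLp = 1 := by
  have h := mem_sphere_zero_iff_norm.1 x.2
  rw [EuclideanSpace.norm_eq, Real.sqrt_eq_one] at h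
  simpa [vecNormSq, Complex.normSq_eq_norm_sq] using h

theorem UnitSphere.ext_ofLp {n : ℕ} {x y : UnitSphere n}
    (h : (x : EuclideanSpace ℂ (Fin n ⊕ Fin n)).ofLp = (y : EuclideanSpace ℂ (Fin n ⊕ Fin n)).ofLp) :
    x = y := Subtype.ext (WithLp.ofLp_injective 2 h)

/-- The last vector of the first half of the standard basis. -/
def lastVec (n : ℕ) : Fin (n + 1) ⊕ Fin (n + 1) → ℂ := Pi.single (Sum.inl (Fin.last n)) 1

theorem vecNormSq_lastVec (n : ℕ) : vecNormSq (lastVec n) = 1 := by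
  rw [vecNormSq, Finset.sum_eq_single (Sum.inl (Fin.last n))]
  · simp [lastVec]
  · intro i _ hi
    simp [lastVec, Pi.single_eq_of_ne hi]
  · simp

theorem USp.proj_ofLp {n : ℕ} (g : USp (n + 1)) :
    (USp.proj n g : EuclideanSpace ℂ (Fin (n + 1) ⊕ Fin (n + 1))).ofLp =
      USp.mat g *ᵥ lastVec n := rfl

theorem USp.mat_incl {n : ℕ} (g : USp n) : USp.mat (USp.incl n g) = blockExtend (USp.mat g) := rfl

theorem blockExtend_injective {n : ℕ} : Function.Injective (blockExtend (n := n)) := by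
  intro A B h
  have h' := (Matrix.reindex (splitIndex n) (splitIndex n)).injective h
  exact (Matrix.fromBlocks_inj.1 h').1

theorem USp.incl_injective (n : ℕ) : Function.Injective (USp.incl n) := fun _ _ h =>
  USp.mat_injective (blockExtend_injective (congrArg USp.mat h))

theorem continuous_blockExtend {n : ℕ} : Continuous (blockExtend (n := n)) := by
  unfold blockExtend
  simp only [Matrix.reindex_apply]
  fun_prop

theorem USp.isClosedEmbedding_incl (n : ℕ) : IsClosedEmbedding (USp.incl n) := by
  refine Continuous.isClosedEmbedding ?_ (USp.incl_injective n)
  rw [USp.continuous_iff]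
  exact continuous_blockExtend.comp USp.continuous_mat

theorem lastVec_comp_splitIndex (n : ℕ) : lastVec n ∘ splitIndex n =
    Sum.elim (0 : Fin n ⊕ Fin n → ℂ) (Pi.single (Sum.inl (0 : Fin 1)) (1 : ℂ)) := by
  ext i
  rcases i with (i | i) | (i | i) <;>
    simp [lastVec, splitIndex, Equiv.sumSumSumComm, Pi.single_apply, Fin.ext_iff,
      Fin.fin_one_eq_zero]
  omega

/-- In the split indices the quaternionic line of e is the ℂ² block. -/
theorem quatCols_lastVec (n : ℕ) : (quatCols (lastVec n)).submatrix (splitIndex n) id =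
    Matrix.fromRows (0 : Matrix (Fin n ⊕ Fin n) (Fin 1 ⊕ Fin 1) ℂ)
      (1 : Matrix (Fin 1 ⊕ Fin 1) (Fin 1 ⊕ Fin 1) ℂ) := by
  ext i j
  rcases j with j | j <;> rcases i with (i | i) | (i | i) <;>
    simp only [quatCols, J_mulVec, Matrix.submatrix_apply, Matrix.of_apply, Sum.elim_inl,
      Sum.elim_inr, Matrix.fromRows_apply_inl, Matrix.fromRows_apply_inr, id_eq] <;>
    simp [lastVec, splitIndex, Equiv.sumSumSumComm, Pi.single_apply,
      Fin.ext_iff, Fin.fin_one_eq_zero, Matrix.one_apply] <;> omega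

theorem USp.incl_mulVec_lastVec {n : ℕ} (g : USp n) :
    USp.mat (USp.incl n g) *ᵥ lastVec n = lastVec n := by
  rw [USp.mat_incl, blockExtend, Matrix.reindex_apply, Matrix.submatrix_mulVec_equiv,
    Equiv.symm_symm, lastVec_comp_splitIndex, Matrix.fromBlocks_mulVec]
  ext i
  obtain ⟨i, rfl⟩ := (splitIndex n).surjective i
  have h := congrFun (lastVec_comp_splitIndex n) i
  simp only [Function.comp_apply] at h
  rw [h]
  rcases i with i | i | i <;> simp [-Sum.elim_zero_single, Fin.fin_one_eq_zero]

/-- Fixing e means fixing its whole quaternionic column, and the adjoint gᴴ = g⁻¹ fixes it too. The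
first fact determines the last block column, the second kills the off-diagonal block of the last
row. -/
theorem USp.exists_incl_of_mulVec_lastVec {n : ℕ} {g : USp (n + 1)}
    (hg : USp.mat g *ᵥ lastVec n = lastVec n) : ∃ h : USp n, USp.incl n h = g := by
  set σ := splitIndex n with hσ
  have h1 : USp.mat g * quatCols (lastVec n) = quatCols (lastVec n) := by
    rw [(USp.isQuat g).mul_quatCols, hg]
  have h2 : (USp.mat g)ᴴ * quatCols (lastVec n) = quatCols (lastVec n) := by
    conv_lhs => rw [← h1]
    rw [← Matrix.mul_assoc, USp.star_mul_self, Matrix.one_mul]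
  obtain ⟨A, B, C, D, hM⟩ : ∃ A B C D, (USp.mat g).submatrix σ σ = Matrix.fromBlocks A B C D :=
    ⟨_, _, _, _, (Matrix.fromBlocks_toBlocks _).symm⟩
  have key : ∀ M : Matrix (Fin (n + 1) ⊕ Fin (n + 1)) (Fin (n + 1) ⊕ Fin (n + 1)) ℂ,
      M * quatCols (lastVec n) = quatCols (lastVec n) →
      M.submatrix σ σ * Matrix.fromRows (0 : Matrix (Fin n ⊕ Fin n) (Fin 1 ⊕ Fin 1) ℂ)
        (1 : Matrix (Fin 1 ⊕ Fin 1) (Fin 1 ⊕ Fin 1) ℂ) =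
        Matrix.fromRows (0 : Matrix (Fin n ⊕ Fin n) (Fin 1 ⊕ Fin 1) ℂ)
          (1 : Matrix (Fin 1 ⊕ Fin 1) (Fin 1 ⊕ Fin 1) ℂ) := by
    intro M h
    rw [← quatCols_lastVec, ← hσ, Matrix.submatrix_mul_equiv, h]
  have h3 := key _ h1
  have h4 := key _ h2
  rw [← Matrix.conjTranspose_submatrix] at h4
  rw [hM, Matrix.fromBlocks_mul_fromRows] at h3
  rw [hM, Matrix.fromBlocks_conjTranspose, Matrix.fromBlocks_mul_fromRows] at h4
  obtain ⟨h3a, h3b⟩ := Matrix.fromRows_inj h3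
  obtain ⟨h4a, h4b⟩ := Matrix.fromRows_inj h4
  simp only [Matrix.mul_zero, Matrix.mul_one, zero_add] at h3a h3b h4a h4b
  rw [Matrix.conjTranspose_eq_zero] at h4a
  subst h3a h3b h4a
  have hgM : USp.mat g = blockExtend A := by
    rw [blockExtend, ← hM, ← hσ]
    simp
  have hA : Aᴴ * A = 1 := by
    apply blockExtend_injective
    rw [blockExtend_mul, ← blockExtend_conjTranspose, ← hgM, USp.star_mul_self, blockExtend_one]
  have hJ : A * Matrix.J (Fin n) ℂ * Aᵀ = Matrix.J (Fin n) ℂ := by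
    have h := USp.mem_symplectic g
    rw [hgM, blockExtend_transpose, J_eq_reindex, blockExtend, blockExtend] at h
    simp only [Matrix.reindex_apply, Matrix.submatrix_mul_equiv, Matrix.fromBlocks_multiply] at h
    have h' := (Matrix.reindex (splitIndex n) (splitIndex n)).injective h
    simpa using (Matrix.fromBlocks_inj.1 h').1
  exact ⟨⟨⟨A, Matrix.mem_unitaryGroup_iff'.2 hA⟩, SymplecticGroup.mem_iff.2 hJ⟩,
    USp.mat_injective hgM.symm⟩

/-- The compact symplectic group acts transitively on the unit vectors. -/
theorem USp.exists_mulVec_eq {n : ℕ} {x y : Fin n ⊕ Fin n → ℂ} (hx : vecNormSq x = 1)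
    (hy : vecNormSq y = 1) : ∃ g : USp n, USp.mat g *ᵥ x = y := by
  by_cases hxy : x = y
  · exact ⟨1, by rw [USp.mat_one, Matrix.one_mulVec, hxy]⟩
  · exact ⟨USp.mk _ (transport_unitary hx hy hxy 1) (isQuat_transport x y 1),
      transport_mulVec hx hy hxy⟩

/-! ### The orbit map: fibres, sections and trivialisations -/

theorem USp.proj_surjective (n : ℕ) : Function.Surjective (USp.proj n) := fun y => by
  obtain ⟨g, hg⟩ := USp.exists_mulVec_eq (vecNormSq_lastVec n) (UnitSphere.vecNormSq_ofLp y)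
  exact ⟨g, UnitSphere.ext_ofLp hg⟩

theorem USp.continuous_proj (n : ℕ) : Continuous (USp.proj n) := by
  refine Continuous.subtype_mk ((PiLp.continuous_toLp 2 _).comp ?_) _
  exact USp.continuous_mat.matrix_mulVec continuous_const

theorem USp.proj_mul_incl {n : ℕ} (g : USp (n + 1)) (h : USp n) :
    USp.proj n (g * USp.incl n h) = USp.proj n g := by
  apply UnitSphere.ext_ofLp
  rw [USp.proj_ofLp, USp.proj_ofLp, USp.mat_mul, ← Matrix.mulVec_mulVec, USp.incl_mulVec_lastVec]

theorem USp.exists_incl_eq_inv_mul {n : ℕ} {a b : USp (n + 1)} (h : USp.proj n a = USp.proj n b) :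
    ∃ k : USp n, USp.incl n k = a⁻¹ * b := by
  apply USp.exists_incl_of_mulVec_lastVec
  have h' := congrArg (fun x : UnitSphere (n + 1) =>
    (x : EuclideanSpace ℂ (Fin (n + 1) ⊕ Fin (n + 1))).ofLp) h
  simp only [USp.proj_ofLp] at h'
  rw [USp.mat_mul, ← Matrix.mulVec_mulVec, ← h', Matrix.mulVec_mulVec, ← USp.mat_mul,
    inv_mul_cancel, USp.mat_one, Matrix.one_mulVec]

/-- Transport from −b to y degenerates only at y = −b; composing it with one k lying over −b lifts y
continuously elsewhere. Starting from the antipode keeps b itself inside the domain. -/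
theorem USp.exists_section {n : ℕ} (b : UnitSphere (n + 1)) :
    ∃ s : UnitSphere (n + 1) → USp (n + 1), ContinuousOn s {y | y ≠ -b} ∧
      ∀ y, y ≠ -b → USp.proj n (s y) = y := by
  classical
  have hb := UnitSphere.vecNormSq_ofLp (-b)
  obtain ⟨k, hk⟩ := USp.proj_surjective n (-b)
  have hne : ∀ y : UnitSphere (n + 1), y ≠ -b →
      (y : EuclideanSpace ℂ (Fin (n + 1) ⊕ Fin (n + 1))).ofLp ≠
        ((-b : UnitSphere (n + 1)) : EuclideanSpace ℂ (Fin (n + 1) ⊕ Fin (n + 1))).ofLp :=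
    fun y hy h => hy (UnitSphere.ext_ofLp h)
  let s : UnitSphere (n + 1) → USp (n + 1) := fun y =>
    if hy : y ≠ -b then USp.mk _ (transport_unitary hb (UnitSphere.vecNormSq_ofLp y)
      (hne y hy).symm 1) (isQuat_transport _ _ 1) * k else 1
  have hs : ∀ y, y ≠ -b → USp.mat (s y) =
      transport ((-b : UnitSphere (n + 1)) : EuclideanSpace ℂ (Fin (n + 1) ⊕ Fin (n + 1))).ofLp
        (y : EuclideanSpace ℂ (Fin (n + 1) ⊕ Fin (n + 1))).ofLp 1 * USp.mat k := fun y hy => by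
    simp only [s, dif_pos hy]
    rw [USp.mat_mul, USp.mat_mk]
  refine ⟨s, ?_, fun y hy => ?_⟩
  · rw [USp.isEmbedding_mat.isInducing.continuousOn_iff]
    refine ContinuousOn.congr ?_ hs
    refine ContinuousOn.mul ?_ continuousOn_const
    exact (continuousOn_transport hb).comp
      ((PiLp.continuous_ofLp 2 _).comp continuous_subtype_val).continuousOn
      fun y hy => ⟨UnitSphere.vecNormSq_ofLp y, hne y hy⟩
  · apply UnitSphere.ext_ofLp
    rw [USp.proj_ofLp, hs y hy, ← Matrix.mulVec_mulVec, ← USp.proj_ofLp, hk,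
      transport_mulVec hb (UnitSphere.vecNormSq_ofLp y) (hne y hy).symm]

/-- The local trivialisation of the orbit map defined by a section over an open set. -/
noncomputable def USp.trivialization {n : ℕ} (U : Set (UnitSphere (n + 1))) (hU : IsOpen U)
    (s : UnitSphere (n + 1) → USp (n + 1)) (hs : ContinuousOn s U)
    (hp : ∀ y ∈ U, USp.proj n (s y) = y) : Bundle.Trivialization (USp n) (USp.proj n) where
  toFun g := (USp.proj n g, Function.invFun (USp.incl n) ((s (USp.proj n g))⁻¹ * g))
  invFun p := s p.1 * USp.incl n p.2
  source := USp.proj n ⁻¹' U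
  target := U ×ˢ univ
  baseSet := U
  map_source' g hg := ⟨hg, mem_univ _⟩
  map_target' p hp' := by
    simp only [mem_preimage, USp.proj_mul_incl, hp p.1 hp'.1]
    exact hp'.1
  left_inv' g hg := by
    have h : ∃ k, USp.incl n k = (s (USp.proj n g))⁻¹ * g :=
      USp.exists_incl_eq_inv_mul (hp _ hg)
    simp only [Function.invFun_eq h, mul_inv_cancel_left]
  right_inv' p hp' := by
    ext1
    · simp only [USp.proj_mul_incl, hp p.1 hp'.1]
    · simp only [USp.proj_mul_incl, hp p.1 hp'.1, inv_mul_cancel_left]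
      exact Function.leftInverse_invFun (USp.incl_injective n) p.2
  open_source := hU.preimage (USp.continuous_proj n)
  open_target := hU.prod isOpen_univ
  continuousOn_toFun := by
    have h1 : ContinuousOn (fun g => (s (USp.proj n g))⁻¹ * g) (USp.proj n ⁻¹' U) :=
      (hs.comp (USp.continuous_proj n).continuousOn fun g hg => hg).inv.mul continuousOn_id
    refine (USp.continuous_proj n).continuousOn.prodMk ?_
    rw [(USp.isClosedEmbedding_incl n).isInducing.continuousOn_iff]
    exact h1.congr fun g hg => Function.invFun_eq (USp.exists_incl_eq_inv_mul (hp _ hg))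
  continuousOn_invFun :=
    (hs.comp continuousOn_fst fun p hp' => hp'.1).mul
      ((USp.isClosedEmbedding_incl n).continuous.comp continuous_snd).continuousOn
  open_baseSet := hU
  source_eq := rfl
  target_eq := rfl
  proj_toFun _ _ := rfl

theorem USp.isPrincipalFibration (n : ℕ) : IsPrincipalFibration (USp.proj n) (USp.incl n) where
  isClosedEmbedding := USp.isClosedEmbedding_incl n
  quotient := by
    have hrel : ∀ a b : USp (n + 1), QuotientGroup.leftRel (USp.incl n).range a b ↔
        USp.proj n a = USp.proj n b := by
      intro a b
      rw [QuotientGroup.leftRel_apply, MonoidHom.mem_range]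
      refine ⟨fun ⟨k, hk⟩ => ?_, USp.exists_incl_eq_inv_mul⟩
      rw [show b = a * USp.incl n k by rw [hk, mul_inv_cancel_left], USp.proj_mul_incl]
    let f : USp (n + 1) ⧸ (USp.incl n).range → UnitSphere (n + 1) :=
      Quotient.lift (USp.proj n) fun a b h => (hrel a b).1 h
    have hf : Continuous f := (USp.continuous_proj n).quotient_lift _
    have hbij : Function.Bijective f := by
      constructor
      · rintro ⟨a⟩ ⟨b⟩ h
        exact Quotient.sound ((hrel a b).2 h)
      · intro y
        obtain ⟨g, rfl⟩ := USp.proj_surjective n y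
        exact ⟨(g : USp (n + 1) ⧸ (USp.incl n).range), rfl⟩
    -- A continuous bijection from a compact space to a Hausdorff space is a homeomorphism.
    have hc : Continuous (Equiv.ofBijective f hbij) := hf
    exact ⟨hc.homeoOfEquivCompactToT2, fun g => rfl⟩
  locallyTrivial b := by
    obtain ⟨s, hs, hp⟩ := USp.exists_section b
    refine ⟨USp.trivialization {y | y ≠ -b} isOpen_ne s hs hp, ?_, fun g hg h => ?_⟩
    · intro h
      exact ne_neg_of_mem_unit_sphere ℂ b h
    -- Equivariance is checked after the injective `USp.incl`: g and g·h have the same base point,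
    -- so the same section value is divided out.
    · have h1 := Function.invFun_eq (USp.exists_incl_eq_inv_mul (hp _ hg))
      have h2 : ∃ k, USp.incl n k = (s (USp.proj n (g * USp.incl n h)))⁻¹ * (g * USp.incl n h) :=
        USp.exists_incl_eq_inv_mul (by rw [USp.proj_mul_incl, hp _ hg])
      have h3 := Function.invFun_eq h2
      apply USp.incl_injective n
      rw [map_mul]
      refine h3.trans ?_
      rw [USp.proj_mul_incl, ← mul_assoc]
      exact congrArg (· * USp.incl n h) h1.symm

/-! ### Curves of matrices -/

section Curves

variable {p q r : Type*} [Fintype p] [Fintype q] [Fintype r]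

/-- The curve of matrices `M` is continuously differentiable. -/
def IsC1Curve {p q : Type*} (M : ℝ → Matrix p q ℂ) : Prop := ∀ i j, ContDiff ℝ 1 fun t => M t i j

/-- The entrywise derivative of a curve of matrices. -/
noncomputable def matVelocity {p q : Type*} (M : ℝ → Matrix p q ℂ) (t : ℝ) : Matrix p q ℂ :=
  Matrix.of fun i j => deriv (fun s => M s i j) t

theorem IsC1Curve.hasDerivAt {p q : Type*} {M : ℝ → Matrix p q ℂ} (hM : IsC1Curve M) (t : ℝ)
    (i : p) (j : q) : HasDerivAt (fun s => M s i j) (matVelocity M t i j) t :=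
  ((hM i j).differentiable one_ne_zero t).hasDerivAt

theorem matVelocity_eq {p q : Type*} {M : ℝ → Matrix p q ℂ} {V : Matrix p q ℂ} {t : ℝ}
    (h : ∀ i j, HasDerivAt (fun s => M s i j) (V i j) t) : matVelocity M t = V := by
  ext i j
  exact (h i j).deriv

theorem isC1Curve_const {p q : Type*} (A : Matrix p q ℂ) : IsC1Curve fun _ => A :=
  fun _ _ => contDiff_const

theorem matVelocity_const {p q : Type*} (A : Matrix p q ℂ) (t : ℝ) :
    matVelocity (fun _ => A) t = 0 :=
  matVelocity_eq fun _ _ => hasDerivAt_const _ _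

omit [Fintype p] [Fintype r] in
theorem IsC1Curve.mul {M : ℝ → Matrix p q ℂ} {N : ℝ → Matrix q r ℂ} (hM : IsC1Curve M)
    (hN : IsC1Curve N) : IsC1Curve fun t => M t * N t := fun i j => by
  simp only [Matrix.mul_apply]
  exact ContDiff.sum fun k _ => (hM i k).mul (hN k j)

omit [Fintype p] [Fintype r] in
theorem matVelocity_mul {M : ℝ → Matrix p q ℂ} {N : ℝ → Matrix q r ℂ} (hM : IsC1Curve M)
    (hN : IsC1Curve N) (t : ℝ) :
    matVelocity (fun t => M t * N t) t = matVelocity M t * N t + M t * matVelocity N t := by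
  refine matVelocity_eq fun i j => ?_
  simp only [Matrix.mul_apply, Matrix.add_apply, ← Finset.sum_add_distrib]
  exact HasDerivAt.fun_sum fun k _ => (hM.hasDerivAt t i k).mul (hN.hasDerivAt t k j)

theorem IsC1Curve.conjTranspose {p q : Type*} {M : ℝ → Matrix p q ℂ} (hM : IsC1Curve M) :
    IsC1Curve fun t => (M t)ᴴ := fun i j =>
  (Complex.conjCLE.contDiff (n := 1)).comp (hM j i)

theorem matVelocity_conjTranspose {p q : Type*} {M : ℝ → Matrix p q ℂ} (hM : IsC1Curve M) (t : ℝ) :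
    matVelocity (fun t => (M t)ᴴ) t = (matVelocity M t)ᴴ :=
  matVelocity_eq fun i j => (hM.hasDerivAt t j i).star

/-! ### The Frobenius norm and its unitary invariance -/

/-- The squared Frobenius norm. -/
noncomputable def frobSq (X : Matrix p q ℂ) : ℝ := ∑ i, ∑ j, Complex.normSq (X i j)

/-- The Frobenius norm. -/
noncomputable def frob (X : Matrix p q ℂ) : ℝ := Real.sqrt (frobSq X)

theorem frobSq_nonneg (X : Matrix p q ℂ) : 0 ≤ frobSq X :=
  Finset.sum_nonneg fun _ _ => Finset.sum_nonneg fun _ _ => Complex.normSq_nonneg _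

theorem trace_conjTranspose_mul_self (X : Matrix p q ℂ) : (Xᴴ * X).trace = (frobSq X : ℂ) := by
  simp only [Matrix.trace, Matrix.diag_apply, Matrix.mul_apply, Matrix.conjTranspose_apply, frobSq,
    Complex.ofReal_sum, Complex.normSq_eq_conj_mul_self]
  exact Finset.sum_comm

theorem frobSq_eq_re_trace (X : Matrix p q ℂ) : frobSq X = (Xᴴ * X).trace.re := by
  rw [trace_conjTranspose_mul_self, Complex.ofReal_re]

theorem frob_eq_norm (X : Matrix p q ℂ) :
    frob X = ‖(WithLp.toLp 2 fun ij => X ij.1 ij.2 : EuclideanSpace ℂ (p × q))‖ := by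
  rw [EuclideanSpace.norm_eq, frob, frobSq, Fintype.sum_prod_type]
  simp [Complex.normSq_eq_norm_sq]

theorem frob_add_le (X Y : Matrix p q ℂ) : frob (X + Y) ≤ frob X + frob Y := by
  rw [frob_eq_norm, frob_eq_norm, frob_eq_norm]
  exact norm_add_le (WithLp.toLp 2 fun ij : p × q => X ij.1 ij.2 : EuclideanSpace ℂ (p × q))
    (WithLp.toLp 2 fun ij : p × q => Y ij.1 ij.2)

theorem frob_smul (c : ℝ) (X : Matrix p q ℂ) : frob (c • X) = |c| * frob X := by
  have h : frobSq (c • X) = c ^ 2 * frobSq X := by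
    simp only [frobSq, Finset.mul_sum, Matrix.smul_apply, Complex.real_smul, Complex.normSq_mul,
      Complex.normSq_ofReal, sq]
  rw [frob, h, Real.sqrt_mul (sq_nonneg c), Real.sqrt_sq_eq_abs, frob]

theorem norm_entry_le_frob (X : Matrix p q ℂ) (i : p) (j : q) : ‖X i j‖ ≤ frob X := by
  rw [frob_eq_norm]
  exact PiLp.norm_apply_le (WithLp.toLp 2 fun ij => X ij.1 ij.2 : EuclideanSpace ℂ (p × q)) (i, j)

theorem continuous_frob : Continuous (frob : Matrix p q ℂ → ℝ) := by
  unfold frob frobSq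
  refine Real.continuous_sqrt.comp (continuous_finsetSum _ fun i _ =>
    continuous_finsetSum _ fun j _ => Complex.continuous_normSq.comp ?_)
  exact continuous_id.matrix_elem i j

theorem frob_zero : frob (0 : Matrix p q ℂ) = 0 := by simp [frob, frobSq]

theorem frobSq_conjTranspose (X : Matrix p q ℂ) : frobSq Xᴴ = frobSq X := by
  unfold frobSq
  rw [Finset.sum_comm]
  simp

theorem frob_unitary_mul [DecidableEq p] {U : Matrix p p ℂ} (hU : Uᴴ * U = 1) (X : Matrix p q ℂ) :
    frob (U * X) = frob X := by
  unfold frob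
  rw [frobSq_eq_re_trace, frobSq_eq_re_trace, Matrix.conjTranspose_mul, Matrix.mul_assoc,
    ← Matrix.mul_assoc Uᴴ, hU, Matrix.one_mul]

theorem frob_mul_unitary [DecidableEq q] {U : Matrix q q ℂ} (hU : Uᴴ * U = 1) (X : Matrix p q ℂ) :
    frob (X * U) = frob X := by
  have hU' : Uᴴᴴ * Uᴴ = 1 := by rw [Matrix.conjTranspose_conjTranspose]; exact mul_eq_one_comm.1 hU
  have h := frob_unitary_mul hU' Xᴴ
  unfold frob at *
  rwa [← Matrix.conjTranspose_mul, frobSq_conjTranspose, frobSq_conjTranspose] at h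

theorem IsC1Curve.continuous_frob_matVelocity {M : ℝ → Matrix p q ℂ} (hM : IsC1Curve M) :
    Continuous fun t => frob (matVelocity M t) :=
  continuous_frob.comp (continuous_matrix fun i j => (hM i j).continuous_deriv le_rfl)

end Curves

/-! ### The Riemannian distance -/

namespace USp

variable {n : ℕ}

theorem IsC1.isC1Curve {γ : ℝ → USp n} (h : IsC1 γ) : IsC1Curve fun t => mat (γ t) := h

theorem velocity_eq (γ : ℝ → USp n) (t : ℝ) : velocity γ t = matVelocity (fun s => mat (γ s)) t := rfl

theorem IsC1.continuous {γ : ℝ → USp n} (h : IsC1 γ) : Continuous γ :=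
  continuous_iff.2 (continuous_matrix fun i j => (h i j).continuous)

/-- The speed of a curve is its Frobenius speed divided by `√2`. -/
theorem IsC1.sqrt_metricSq {γ : ℝ → USp n} (h : IsC1 γ) (t : ℝ) :
    Real.sqrt (metricSq (γ t) (velocity γ t)) = frob (velocity γ t) / Real.sqrt 2 := by
  set X := velocity γ t with hX
  -- Differentiating γᴴγ = 1 shows that γᴴγ′ is skew, so −Tr((γ⁻¹γ′)²) is the squared Frobenius norm
  -- of γ′.
  have h1 : Xᴴ * mat (γ t) + (mat (γ t))ᴴ * X = 0 := by
    have h2 := matVelocity_mul h.isC1Curve.conjTranspose h.isC1Curve t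
    rw [matVelocity_conjTranspose h.isC1Curve, ← velocity_eq, ← hX] at h2
    rw [← h2]
    simp only [star_mul_self]
    exact matVelocity_const _ _
  have hskew : (mat (γ t))ᴴ * X = -((mat (γ t))ᴴ * X)ᴴ := by
    rw [Matrix.conjTranspose_mul, Matrix.conjTranspose_conjTranspose]
    exact eq_neg_of_add_eq_zero_right h1
  have h3 : metricSq (γ t) X = frobSq X / 2 := by
    have h4 : ((mat (γ t))ᴴ * X) * ((mat (γ t))ᴴ * X) = -(Xᴴ * X) := by
      conv_lhs => enter [1]; rw [hskew]
      rw [Matrix.conjTranspose_mul, Matrix.conjTranspose_conjTranspose, Matrix.neg_mul,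
        Matrix.mul_assoc, ← Matrix.mul_assoc (mat (γ t)), mul_star_self, Matrix.one_mul]
    rw [metricSq, mat_inv, h4, Matrix.trace_neg, trace_conjTranspose_mul_self]
    rw [neg_mul_neg, show (1 / 2 : ℂ) = ((1 / 2 : ℝ) : ℂ) by push_cast; rfl, ← Complex.ofReal_mul,
      Complex.ofReal_re]
    ring
  rw [h3, Real.sqrt_div (frobSq_nonneg _), frob]

theorem IsC1.length_eq {γ : ℝ → USp n} (h : IsC1 γ) :
    length γ = (∫ t in (0 : ℝ)..1, frob (velocity γ t)) / Real.sqrt 2 := by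
  unfold length
  simp only [h.sqrt_metricSq]
  exact intervalIntegral.integral_div _ _

theorem IsC1.intervalIntegrable {γ : ℝ → USp n} (h : IsC1 γ) :
    IntervalIntegrable (fun t => frob (velocity γ t)) volume 0 1 :=
  h.isC1Curve.continuous_frob_matVelocity.intervalIntegrable _ _

theorem length_nonneg (γ : ℝ → USp n) : 0 ≤ length γ :=
  intervalIntegral.integral_nonneg zero_le_one fun _ _ => Real.sqrt_nonneg _

theorem IsC1.length_le {γ : ℝ → USp n} (h : IsC1 γ) {C : ℝ}
    (hC : ∀ t, frob (velocity γ t) ≤ C) : length γ ≤ C / Real.sqrt 2 := by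
  rw [h.length_eq]
  gcongr
  calc ∫ t in (0 : ℝ)..1, frob (velocity γ t) ≤ ∫ _t in (0 : ℝ)..1, C :=
        intervalIntegral.integral_mono_on zero_le_one h.intervalIntegrable
          intervalIntegrable_const fun t _ => hC t
    _ = C := by simp

theorem riemannianDist_le {γ : ℝ → USp n} (h : IsC1 γ) :
    riemannianDist (γ 0) (γ 1) ≤ ENNReal.ofReal (length γ) :=
  iInf₂_le_of_le γ ⟨h, rfl, rfl⟩ le_rfl

theorem isC1_const (a : USp n) : IsC1 fun _ => a := isC1Curve_const _

theorem IsC1.mul {γ δ : ℝ → USp n} (hγ : IsC1 γ) (hδ : IsC1 δ) : IsC1 fun t => γ t * δ t :=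
  hγ.isC1Curve.mul hδ.isC1Curve

theorem IsC1.velocity_mul {γ δ : ℝ → USp n} (hγ : IsC1 γ) (hδ : IsC1 δ) (t : ℝ) :
    velocity (fun t => γ t * δ t) t =
      velocity γ t * mat (δ t) + mat (γ t) * velocity δ t :=
  matVelocity_mul hγ.isC1Curve hδ.isC1Curve t

/-- The Leibniz rule and unitary invariance of the Frobenius norm bound the speed of a product by
the sum of the speeds. -/
theorem IsC1.length_mul_le {γ δ : ℝ → USp n} (hγ : IsC1 γ) (hδ : IsC1 δ) :
    length (fun t => γ t * δ t) ≤ length γ + length δ := by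
  rw [hγ.length_eq, hδ.length_eq, (hγ.mul hδ).length_eq, ← add_div,
    ← intervalIntegral.integral_add hγ.intervalIntegrable hδ.intervalIntegrable]
  gcongr
  refine intervalIntegral.integral_mono_on zero_le_one (hγ.mul hδ).intervalIntegrable
    (hγ.intervalIntegrable.add hδ.intervalIntegrable) fun t _ => ?_
  rw [hγ.velocity_mul hδ]
  refine (frob_add_le _ _).trans_eq ?_
  rw [frob_mul_unitary (star_mul_self _), frob_unitary_mul (star_mul_self _)]

theorem length_const (a : USp n) : length (fun _ => a) = 0 := by
  have h : velocity (fun _ : ℝ => a) = fun _ => 0 := funext fun t => matVelocity_const _ t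
  rw [(isC1_const a).length_eq, h]
  simp [frob_zero]

theorem IsC1.length_reverse {γ : ℝ → USp n} (h : IsC1 γ) :
    IsC1 (fun t => γ (1 - t)) ∧ length (fun t => γ (1 - t)) = length γ := by
  have h1 : IsC1 (fun t => γ (1 - t)) := fun i j =>
    (h i j).comp (contDiff_const.sub contDiff_id)
  refine ⟨h1, ?_⟩
  have h2 : ∀ t, velocity (fun t => γ (1 - t)) t = (-1 : ℝ) • velocity γ (1 - t) := fun t => by
    refine matVelocity_eq fun i j => ?_
    exact ((h.isC1Curve.hasDerivAt (1 - t) i j).comp_const_sub 1 t).congr_deriv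
      (by simp [velocity_eq])
  rw [h1.length_eq, h.length_eq]
  simp only [h2, frob_smul, abs_neg, abs_one, one_mul]
  rw [intervalIntegral.integral_comp_sub_left fun t => frob (velocity γ t)]
  simp

theorem riemannianDist_self (a : USp n) : riemannianDist a a = 0 := by
  have h := riemannianDist_le (isC1_const a)
  rwa [length_const, ENNReal.ofReal_zero, nonpos_iff_eq_zero] at h

theorem riemannianDist_symm_le (a b : USp n) : riemannianDist a b ≤ riemannianDist b a := by
  refine le_iInf₂ fun γ ⟨hγ, h0, h1⟩ => ?_
  have h := riemannianDist_le hγ.length_reverse.1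
  rw [hγ.length_reverse.2] at h
  simpa [h0, h1] using h

/-- Concatenation would create corners. The pointwise product γ(t) b⁻¹ δ(t) is again C¹, runs from a
to c, and is no longer than γ and δ together. -/
theorem riemannianDist_triangle (a b c : USp n) :
    riemannianDist a c ≤ riemannianDist a b + riemannianDist b c := by
  have key : ∀ γ : ℝ → USp n, IsC1 γ ∧ γ 0 = a ∧ γ 1 = b → ∀ δ : ℝ → USp n,
      IsC1 δ ∧ δ 0 = b ∧ δ 1 = c →
      riemannianDist a c ≤ ENNReal.ofReal (length γ) + ENNReal.ofReal (length δ) := by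
    rintro γ ⟨hγ, hγ0, hγ1⟩ δ ⟨hδ, hδ0, hδ1⟩
    have h1 := hγ.mul (isC1_const b⁻¹)
    have h := riemannianDist_le (h1.mul hδ)
    simp only [hγ0, hγ1, hδ0, hδ1, inv_mul_cancel_right, mul_inv_cancel, one_mul] at h
    refine h.trans ?_
    rw [← ENNReal.ofReal_add (length_nonneg _) (length_nonneg _)]
    refine ENNReal.ofReal_le_ofReal ((h1.length_mul_le hδ).trans (add_le_add ?_ le_rfl))
    simpa [length_const] using hγ.length_mul_le (isC1_const b⁻¹)
  calc riemannianDist a c ≤ ⨅ (γ : ℝ → USp n) (_ : IsC1 γ ∧ γ 0 = a ∧ γ 1 = b),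
        (ENNReal.ofReal (length γ) + riemannianDist b c) := by
        refine le_iInf₂ fun γ hγ => ?_
        simp only [riemannianDist.eq_1 b c, ENNReal.add_iInf]
        exact le_iInf₂ (key γ hγ)
    _ = riemannianDist a b + riemannianDist b c := by
        simp only [riemannianDist.eq_1 a b, ENNReal.iInf_add]

/-- The entrywise chordal distance is controlled by the Riemannian distance. -/
theorem norm_mat_sub_le (a b : USp n) (i j : Fin n ⊕ Fin n) :
    ENNReal.ofReal (‖mat b i j - mat a i j‖ / Real.sqrt 2) ≤ riemannianDist a b := by
  refine le_iInf₂ fun γ ⟨hγ, h0, h1⟩ => ENNReal.ofReal_le_ofReal ?_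
  rw [hγ.length_eq]
  gcongr
  -- The entry difference is the integral of the entry of the velocity, which the Frobenius norm
  -- dominates.
  have hd : ∫ t in (0 : ℝ)..1, velocity γ t i j = mat b i j - mat a i j := by
    rw [← h0, ← h1]
    exact intervalIntegral.integral_eq_sub_of_hasDerivAt (fun t _ => hγ.isC1Curve.hasDerivAt t i j)
      (((hγ i j).continuous_deriv le_rfl).intervalIntegrable _ _)
  rw [← hd]
  refine (intervalIntegral.norm_integral_le_integral_norm zero_le_one).trans ?_
  exact intervalIntegral.integral_mono_on zero_le_one
    (((hγ i j).continuous_deriv le_rfl).norm.intervalIntegrable _ _) hγ.intervalIntegrable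
    fun t _ => norm_entry_le_frob _ i j

end USp

/-! ### Cayley curves -/

section Cayley

variable {l : Type*} [Fintype l] [DecidableEq l]

/-- The Cayley curve `(1 + tY) (1 - tY)⁻¹`. -/
noncomputable def cayley {l : Type*} [Fintype l] [DecidableEq l] (Y : Matrix l l ℂ) (t : ℝ) :
    Matrix l l ℂ := (1 + t • Y) * (1 - t • Y)⁻¹

open ComplexOrder in
-- For skew Y the cross terms cancel: (1 − tY)ᴴ(1 − tY) = 1 + (tY)ᴴ(tY) is positive definite. Cayley
-- curves are therefore defined for all t.
theorem isUnit_det_one_sub_smul {Y : Matrix l l ℂ} (hY : Yᴴ = -Y) (t : ℝ) :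
    IsUnit (1 - t • Y).det := by
  have h1 : (1 - t • Y)ᴴ * (1 - t • Y) = 1 + (t • Y)ᴴ * (t • Y) := by
    simp only [Matrix.conjTranspose_sub, Matrix.conjTranspose_one, Matrix.conjTranspose_smul,
      star_trivial, hY, smul_neg]
    generalize t • Y = Z
    noncomm_ring
  have h2 : ((1 - t • Y)ᴴ * (1 - t • Y)).PosDef := by
    rw [h1]
    exact Matrix.PosDef.one.add_posSemidef (Matrix.posSemidef_conjTranspose_mul_self _)
  have h3 := (Matrix.isUnit_iff_isUnit_det _).1 h2.isUnit
  rw [Matrix.det_mul] at h3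
  exact isUnit_of_mul_isUnit_right h3

theorem cayley_mul {Y : Matrix l l ℂ} (hY : Yᴴ = -Y) (t : ℝ) :
    cayley Y t * (1 - t • Y) = 1 + t • Y := by
  rw [cayley, Matrix.mul_assoc, Matrix.nonsing_inv_mul _ (isUnit_det_one_sub_smul hY t),
    Matrix.mul_one]

theorem cayley_zero {Y : Matrix l l ℂ} : cayley Y 0 = 1 := by simp [cayley]

/-- With P = 1 − tY the numerator is Pᴴ, which commutes with P. -/
theorem cayley_unitary {Y : Matrix l l ℂ} (hY : Yᴴ = -Y) (t : ℝ) :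
    (cayley Y t)ᴴ * cayley Y t = 1 := by
  have hP := isUnit_det_one_sub_smul hY t
  set P := 1 - t • Y with hPd
  have hQ : (1 + t • Y)ᴴ = P := by simp [hPd, Matrix.conjTranspose_smul, hY, sub_eq_add_neg]
  have hQ' : Pᴴ = 1 + t • Y := by rw [← hQ, Matrix.conjTranspose_conjTranspose]
  have hcomm : P * Pᴴ = Pᴴ * P := by
    rw [hQ', hPd]; generalize t • Y = Z; noncomm_ring
  have hP' : IsUnit (Pᴴ).det := by rw [Matrix.det_conjTranspose]; exact hP.star
  rw [cayley, Matrix.conjTranspose_mul, hQ, ← hQ', Matrix.conjTranspose_nonsing_inv,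
    Matrix.mul_assoc, ← Matrix.mul_assoc P, hcomm, Matrix.mul_assoc, Matrix.mul_nonsing_inv _ hP,
    Matrix.mul_one, Matrix.nonsing_inv_mul _ hP']

theorem isQuat_cayley {Y : Matrix (l ⊕ l) (l ⊕ l) ℂ} (hY : Yᴴ = -Y) (hq : IsQuat Y) (t : ℝ) :
    IsQuat (cayley Y t) :=
  (IsQuat.one.add (hq.smul t)).mul ((IsQuat.one.sub (hq.smul t)).inv (isUnit_det_one_sub_smul hY t))

theorem contDiff_det {A : ℝ → Matrix l l ℂ} (hA : IsC1Curve A) :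
    ContDiff ℝ 1 fun t => (A t).det := by
  simp only [Matrix.det_apply]
  exact ContDiff.sum fun σ _ => (contDiff_prod fun i _ => hA _ _).const_smul _

/-- Cramer's rule: the entries are quotients of polynomials in those of A. -/
theorem IsC1Curve.inv {A : ℝ → Matrix l l ℂ} (hA : IsC1Curve A) (h : ∀ t, IsUnit (A t).det) :
    IsC1Curve fun t => (A t)⁻¹ := by
  intro i j
  have h1 : ∀ t, (A t)⁻¹ i j = ((A t).det)⁻¹ * (A t).adjugate i j := fun t => by
    rw [Matrix.inv_def, Ring.inverse_eq_inv']; rfl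
  simp only [h1, Matrix.adjugate_apply]
  refine ((contDiff_det hA).inv fun t => (h t).ne_zero).mul (contDiff_det fun a b => ?_)
  by_cases hab : a = j
  · subst hab
    simp only [Matrix.updateRow_self]
    exact contDiff_const
  · simp only [Matrix.updateRow_ne hab]
    exact hA a b

theorem isC1Curve_cayley {Y : Matrix l l ℂ} (hY : Yᴴ = -Y) : IsC1Curve (cayley Y) := by
  refine IsC1Curve.mul (fun i j => ?_) (IsC1Curve.inv (fun i j => ?_) (isUnit_det_one_sub_smul hY))
  · simp only [Matrix.add_apply, Matrix.smul_apply]; fun_prop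
  · simp only [Matrix.sub_apply, Matrix.smul_apply]; fun_prop

/-- By the same cancellation, |(1 − tY)Z|² = |Z|² + |tYZ|². Hence (1 − tY)⁻¹ is a contraction. -/
theorem frob_le_frob_one_sub_mul {Y : Matrix l l ℂ} (hY : Yᴴ = -Y) (t : ℝ) (Z : Matrix l l ℂ) :
    frob Z ≤ frob ((1 - t • Y) * Z) := by
  refine Real.sqrt_le_sqrt ?_
  have h1 : ((1 - t • Y) * Z)ᴴ * ((1 - t • Y) * Z) = Zᴴ * Z + ((t • Y) * Z)ᴴ * ((t • Y) * Z) := by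
    simp only [Matrix.conjTranspose_mul, Matrix.conjTranspose_sub, Matrix.conjTranspose_smul, hY,
      Matrix.conjTranspose_one, star_trivial, smul_neg]
    generalize t • Y = T
    noncomm_ring
  have h2 : frobSq ((1 - t • Y) * Z) = frobSq Z + frobSq ((t • Y) * Z) := by
    simp only [frobSq_eq_re_trace, h1, Matrix.trace_add, Complex.add_re]
  rw [h2]
  exact le_add_of_nonneg_right (frobSq_nonneg _)

/-- Differentiating `cayley Y t * (1 - t • Y) = 1 + t • Y` gives the velocity 2R²Y with R = (1 −
tY)⁻¹, and R is a contraction. -/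
theorem frob_matVelocity_cayley_le {Y : Matrix l l ℂ} (hY : Yᴴ = -Y) (t : ℝ) :
    frob (matVelocity (cayley Y) t) ≤ 2 * frob Y := by
  have hP := isUnit_det_one_sub_smul hY t
  set V := matVelocity (cayley Y) t with hV
  have h1 : V * (1 - t • Y) - cayley Y t * Y = Y := by
    have hlin : ∀ c : ℝ, ∀ i j, HasDerivAt (fun s : ℝ => (1 + (c * s) • Y) i j) ((c • Y) i j) t := by
      intro c i j
      simp only [Matrix.add_apply, Matrix.smul_apply]
      exact ((((hasDerivAt_id t).const_mul c).smul_const (Y i j)).const_add _).congr_deriv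
        (by simp)
    have hsub : (fun s : ℝ => 1 - s • Y) = fun s : ℝ => 1 + ((-1) * s) • Y := by
      funext s; rw [neg_one_mul, neg_smul, sub_eq_add_neg]
    have hadd : (fun s : ℝ => 1 + s • Y) = fun s : ℝ => 1 + (1 * s) • Y := by
      funext s; rw [one_mul]
    have hc : IsC1Curve fun s : ℝ => 1 - s • Y := fun i j => by
      simp only [Matrix.sub_apply, Matrix.smul_apply]; fun_prop
    have h2 := matVelocity_mul (isC1Curve_cayley hY) hc t
    simp only [cayley_mul hY] at h2
    rw [hadd, matVelocity_eq (hlin 1), hsub, matVelocity_eq (hlin (-1)), ← hV] at h2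
    simp only [one_smul, neg_smul, Matrix.mul_neg, ← sub_eq_add_neg] at h2
    exact h2.symm
  set P := 1 - t • Y with hPd
  set R := P⁻¹ with hR
  have hPR : P * R = 1 := Matrix.mul_nonsing_inv _ hP
  have hRP : R * P = 1 := Matrix.nonsing_inv_mul _ hP
  have hYP : Y * P = P * Y := by rw [hPd]; noncomm_ring
  have hRY : R * Y = Y * R := by
    calc R * Y = R * (Y * (P * R)) := by rw [hPR, Matrix.mul_one]
      _ = R * (P * Y) * R := by rw [← hYP]; simp only [Matrix.mul_assoc]
      _ = Y * R := by rw [← Matrix.mul_assoc, hRP, Matrix.one_mul]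
  have hc : 1 + cayley Y t = (2 : ℝ) • R := by
    calc 1 + cayley Y t = (P + (1 + t • Y)) * R := by rw [Matrix.add_mul, hPR, cayley]
      _ = (2 : ℝ) • R := by 
        rw [show P + (1 + t • Y) = (2 : ℝ) • 1 by rw [hPd, two_smul]; abel, Matrix.smul_mul,
          Matrix.one_mul]
  have h2 : V = (2 : ℝ) • (R * (R * Y)) := by
    calc V = V * P * R := by rw [Matrix.mul_assoc, hPR, Matrix.mul_one]
      _ = ((1 + cayley Y t) * Y) * R := by
        rw [sub_eq_iff_eq_add.1 h1, Matrix.add_mul 1, Matrix.one_mul]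
      _ = (2 : ℝ) • (R * (R * Y)) := by
        rw [hc, Matrix.smul_mul, Matrix.smul_mul, Matrix.mul_assoc, hRY]
  have hle : ∀ Z, frob (R * Z) ≤ frob Z := fun Z => by
    have h := frob_le_frob_one_sub_mul hY t (R * Z)
    rwa [← hPd, ← Matrix.mul_assoc, hPR, Matrix.one_mul] at h
  rw [h2, frob_smul, abs_of_pos two_pos]
  gcongr
  exact (hle _).trans (hle _)

end Cayley

/-! ### Connectedness, and compatibility of the distance with the topology -/

namespace USp

variable {n : ℕ}

/-- The Cayley transform of an element of the Lie algebra moves points by a controlled distance. -/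
theorem riemannianDist_mul_cayley_le (g : USp n)
    {Y : Matrix (Fin n ⊕ Fin n) (Fin n ⊕ Fin n) ℂ} (hY : Yᴴ = -Y) (hq : IsQuat Y) :
    riemannianDist g (g * mk (cayley Y 1) (cayley_unitary hY 1) (isQuat_cayley hY hq 1)) ≤
      ENNReal.ofReal (2 * frob Y / Real.sqrt 2) := by
  let γ : ℝ → USp n := fun t => mk (cayley Y t) (cayley_unitary hY t) (isQuat_cayley hY hq t)
  have hγ : IsC1 γ := isC1Curve_cayley hY
  have hgγ := (isC1_const g).mul hγ
  have h := riemannianDist_le hgγ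
  have h0 : γ 0 = 1 := mat_injective cayley_zero
  simp only [h0, mul_one] at h
  refine h.trans (ENNReal.ofReal_le_ofReal (hgγ.length_le fun t => ?_))
  rw [(isC1_const g).velocity_mul hγ, velocity_eq (fun _ => g), matVelocity_const, Matrix.zero_mul,
    zero_add, frob_unitary_mul (star_mul_self _)]
  exact frob_matVelocity_cayley_le hY t

theorem IsC1.incl {γ : ℝ → USp n} (h : IsC1 γ) : IsC1 fun t => incl n (γ t) := by
  intro i j
  obtain ⟨i, rfl⟩ := (splitIndex n).surjective i
  obtain ⟨j, rfl⟩ := (splitIndex n).surjective j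
  simp only [mat_incl, blockExtend, Matrix.reindex_apply, Matrix.submatrix_apply,
    Equiv.symm_apply_apply]
  rcases i with i | i <;> rcases j with j | j
  · simpa using h i j
  · simpa using contDiff_const
  · simpa using contDiff_const
  · simpa using contDiff_const

/-- Every element is the end point of a continuously differentiable curve from the identity. -/
theorem exists_isC1_one (g : USp n) : ∃ γ : ℝ → USp n, IsC1 γ ∧ γ 0 = 1 ∧ γ 1 = g := by
  induction n with
  | zero =>
    refine ⟨fun _ => 1, isC1_const 1, rfl, mat_injective ?_⟩
    ext i
    rcases i with i | i <;> exact i.elim0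
  | succ n ih =>
    -- The stabiliser of e is a copy of `USp n`, covered by induction. Any other g is brought into
    -- it by dividing out the quasi-reflection δ 1 that sends e to ge, itself joined to 1 by δ.
    have hfix : ∀ g : USp (n + 1), mat g *ᵥ lastVec n = lastVec n →
        ∃ γ : ℝ → USp (n + 1), IsC1 γ ∧ γ 0 = 1 ∧ γ 1 = g := by
      intro g hg
      obtain ⟨k, rfl⟩ := exists_incl_of_mulVec_lastVec hg
      obtain ⟨γ, h, h0, h1⟩ := ih k
      exact ⟨_, h.incl, by simp only [h0, map_one], by simp only [h1]⟩
    by_cases hg : lastVec n = mat g *ᵥ lastVec n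
    · exact hfix g hg.symm
    · have hx := vecNormSq_lastVec n
      have hy : vecNormSq (mat g *ᵥ lastVec n) = 1 := UnitSphere.vecNormSq_ofLp (proj n g)
      let δ : ℝ → USp (n + 1) := fun t => mk _ (transport_unitary hx hy hg t) (isQuat_transport _ _ t)
      have hδ : IsC1 δ := contDiff_transport hx hy hg
      have hδ0 : δ 0 = 1 := mat_injective transport_zero
      have hδ1 : mat (δ 1) *ᵥ lastVec n = mat g *ᵥ lastVec n := transport_mulVec hx hy hg
      obtain ⟨γ, h, h0, h1⟩ := hfix ((δ 1)⁻¹ * g) (by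
        rw [mat_mul, ← Matrix.mulVec_mulVec, ← hδ1, Matrix.mulVec_mulVec, ← mat_mul,
          inv_mul_cancel, mat_one, Matrix.one_mulVec])
      exact ⟨_, hδ.mul h, by simp only [hδ0, h0, one_mul], by simp only [h1, mul_inv_cancel_left]⟩

theorem exists_isC1 (a b : USp n) : ∃ γ : ℝ → USp n, IsC1 γ ∧ γ 0 = a ∧ γ 1 = b := by
  obtain ⟨γ, h, h0, h1⟩ := exists_isC1_one (a⁻¹ * b)
  exact ⟨_, (isC1_const a).mul h, by simp only [h0, mul_one],
    by simp only [h1, mul_inv_cancel_left]⟩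

instance : ConnectedSpace (USp n) := by
  have : PathConnectedSpace (USp n) := by
    refine ⟨⟨1⟩, fun a b => ?_⟩
    obtain ⟨γ, h, h0, h1⟩ := exists_isC1 a b
    exact ⟨⟨⟨fun t => γ t, h.continuous.comp continuous_subtype_val⟩, h0, h1⟩⟩
  infer_instance

theorem riemannianDist_ne_top (a b : USp n) : riemannianDist a b ≠ ∞ := by
  obtain ⟨γ, h, rfl, rfl⟩ := exists_isC1 a b
  exact ne_top_of_le_ne_top ENNReal.ofReal_ne_top (riemannianDist_le h)

/-- Near 1 the Cayley transform is inverted by Y = (y − 1)(y + 1)⁻¹, which is skew, quaternionic,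
continuous and 0 at y = 1. The Cayley curve from g to gy is thus arbitrarily short. -/
theorem eventually_riemannianDist_lt (g : USp n) {ε : ℝ} (hε : 0 < ε) :
    ∀ᶠ y in 𝓝 (1 : USp n), riemannianDist g (g * y) < ENNReal.ofReal ε := by
  have hdet : (1 + 1 : Matrix (Fin n ⊕ Fin n) (Fin n ⊕ Fin n) ℂ).det ≠ 0 := by
    rw [one_add_one_eq_two, ← Matrix.diagonal_ofNat, Matrix.det_diagonal]
    simp
  let Y : Matrix (Fin n ⊕ Fin n) (Fin n ⊕ Fin n) ℂ → Matrix (Fin n ⊕ Fin n) (Fin n ⊕ Fin n) ℂ :=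
    fun y => (y - 1) * (y + 1)⁻¹
  have hYc : ContinuousAt (fun y : USp n => 2 * frob (Y (mat y)) / Real.sqrt 2) 1 := by
    refine ContinuousAt.div_const (ContinuousAt.mul continuousAt_const ?_) _
    refine continuous_frob.continuousAt.comp (ContinuousAt.mul ?_ ?_)
    · exact (continuous_mat.sub continuous_const).continuousAt
    · have h1 : ContinuousAt (Inv.inv : Matrix (Fin n ⊕ Fin n) (Fin n ⊕ Fin n) ℂ → _)
          (mat (1 : USp n) + 1) := by
        refine continuousAt_matrix_inv _ ?_
        rw [Ring.inverse_eq_inv']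
        exact continuousAt_inv₀ hdet
      exact ContinuousAt.comp (f := fun y : USp n => mat y + 1) h1
        (continuous_mat.add continuous_const).continuousAt
  have hY1 : 2 * frob (Y (mat (1 : USp n))) / Real.sqrt 2 < ε := by
    simpa [Y, mat_one, frob_zero] using hε
  have hd : ∀ᶠ y in 𝓝 (1 : USp n), (mat y + 1).det ≠ 0 :=
    (continuous_mat.add continuous_const).matrix_det.continuousAt.eventually_ne hdet
  filter_upwards [hYc.eventually_lt_const hY1, hd] with y hy hdy
  set M := mat y with hM
  have hu : IsUnit (M + 1).det := hdy.isUnit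
  have hMM : Mᴴ * M = 1 := star_mul_self y
  have hu' : IsUnit (M + 1)ᴴ.det := by rw [Matrix.det_conjTranspose]; exact hu.star
  have hskew : (Y M)ᴴ = -Y M := by
    have h1 : (M - 1)ᴴ * (M + 1) = -((M + 1)ᴴ * (M - 1)) := by
      simp only [Matrix.conjTranspose_sub, Matrix.conjTranspose_add, Matrix.conjTranspose_one,
        Matrix.sub_mul, Matrix.mul_add, Matrix.add_mul, Matrix.mul_sub, hMM]
      noncomm_ring
    calc (Y M)ᴴ = ((M + 1)ᴴ)⁻¹ * ((M - 1)ᴴ * (M + 1)) * (M + 1)⁻¹ := by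
          rw [Matrix.mul_assoc, Matrix.mul_assoc (M - 1)ᴴ, Matrix.mul_nonsing_inv _ hu,
            Matrix.mul_one, Matrix.conjTranspose_mul, Matrix.conjTranspose_nonsing_inv]
      _ = -Y M := by
          rw [h1, Matrix.mul_neg, Matrix.neg_mul, ← Matrix.mul_assoc, Matrix.nonsing_inv_mul _ hu',
            Matrix.one_mul]
  have hq : IsQuat (Y M) :=
    ((isQuat y).sub IsQuat.one).mul (((isQuat y).add IsQuat.one).inv hu)
  have hend : mk (cayley (Y M) 1) (cayley_unitary hskew 1) (isQuat_cayley hskew hq 1) = y := by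
    apply mat_injective
    rw [mat_mk]
    have h1 : M * (1 - (1 : ℝ) • Y M) = 1 + (1 : ℝ) • Y M := by
      have h2 : (1 : Matrix (Fin n ⊕ Fin n) (Fin n ⊕ Fin n) ℂ) = (M + 1) * (M + 1)⁻¹ :=
        (Matrix.mul_nonsing_inv _ hu).symm
      have h3 : 1 - Y M = (2 : ℝ) • (M + 1)⁻¹ := by
        conv_lhs => enter [1]; rw [h2]
        rw [← Matrix.sub_mul, show M + 1 - (M - 1) = (2 : ℝ) • 1 by rw [two_smul]; abel,
          Matrix.smul_mul, Matrix.one_mul]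
      have h4 : 1 + Y M = (2 : ℝ) • (M * (M + 1)⁻¹) := by
        conv_lhs => enter [1]; rw [h2]
        rw [← Matrix.add_mul, two_smul, ← Matrix.add_mul]
        congr 1
        abel
      rw [one_smul, h3, h4, Matrix.mul_smul]
    rw [cayley, ← h1, Matrix.mul_assoc, Matrix.mul_nonsing_inv _ (isUnit_det_one_sub_smul hskew 1),
      Matrix.mul_one]
  have h := riemannianDist_mul_cayley_le g hskew hq
  rw [hend] at h
  exact h.trans_lt ((ENNReal.ofReal_lt_ofReal_iff hε).2 hy)

theorem exists_dist_of_isOpen {U : Set (USp n)} (hU : IsOpen U) {x : USp n} (hx : x ∈ U) :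
    ∃ δ > 0, ∀ y, (∀ i j, ‖mat y i j - mat x i j‖ < δ) → y ∈ U := by
  obtain ⟨V, hV, rfl⟩ := isEmbedding_mat.isInducing.isOpen_iff.1 hU
  have hV' : IsOpen (X := (Fin n ⊕ Fin n) → (Fin n ⊕ Fin n) → ℂ) V := hV
  obtain ⟨δ, hδ, h⟩ := Metric.isOpen_iff.1 hV' (mat x) hx
  refine ⟨δ, hδ, fun y hy => h ((dist_pi_lt_iff hδ).2 fun i =>
    (dist_pi_lt_iff hδ).2 fun j => ?_)⟩
  rw [dist_eq_norm]
  exact hy i j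

theorem norm_sub_lt_of_riemannianDist_lt {x y : USp n} {δ : ℝ}
    (h : riemannianDist x y < ENNReal.ofReal (δ / Real.sqrt 2)) (i j : Fin n ⊕ Fin n) :
    ‖mat y i j - mat x i j‖ < δ := by
  have h1 := (norm_mat_sub_le x y i j).trans_lt h
  have h2 := (ENNReal.ofReal_lt_ofReal_iff_of_nonneg (by positivity)).1 h1
  exact (div_lt_div_iff_of_pos_right (by positivity)).1 h2

theorem isCompatibleMetric_riemannianDist (n : ℕ) :
    IsCompatibleMetric (riemannianDist (n := n)) where
  finite := riemannianDist_ne_top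
  eq_zero_iff x y := by
    refine ⟨fun h => mat_injective ?_, ?_⟩
    · ext i j
      have h1 := norm_mat_sub_le x y i j
      rw [h, nonpos_iff_eq_zero, ENNReal.ofReal_eq_zero] at h1
      have h2 : ‖mat y i j - mat x i j‖ ≤ 0 := by
        by_contra h3
        push Not at h3
        exact absurd h1 (not_le.2 (by positivity))
      exact (sub_eq_zero.1 (norm_le_zero_iff.1 h2)).symm
    · rintro rfl
      exact riemannianDist_self x
  symm x y := le_antisymm (riemannianDist_symm_le x y) (riemannianDist_symm_le y x)
  triangle := riemannianDist_triangle
  isOpen_iff U := by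
    constructor
    · intro hU x hx
      obtain ⟨δ, hδ, h⟩ := exists_dist_of_isOpen hU hx
      exact ⟨δ / Real.sqrt 2, by positivity, fun y hy => h y (norm_sub_lt_of_riemannianDist_lt hy)⟩
    · intro h
      refine isOpen_iff_mem_nhds.2 fun x hx => ?_
      obtain ⟨ε, hε, hU⟩ := h x hx
      have h1 : Tendsto (fun y => x⁻¹ * y) (𝓝 x) (𝓝 1) := by
        have := (continuous_const_mul x⁻¹).tendsto x
        rwa [inv_mul_cancel] at this
      filter_upwards [h1.eventually (eventually_riemannianDist_lt x hε)] with y hy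
      rw [mul_inv_cancel_left] at hy
      exact hU y hy

end USp

/-! ### Regular zero sets -/

theorem isSmoothSubmanifold_of_regular {V W : Type*} [NormedAddCommGroup V] [NormedSpace ℝ V]
    [NormedAddCommGroup W] [NormedSpace ℝ W] [FiniteDimensional ℝ W] {d : ℕ} {F : V → W}
    {M : Set V} (hF : ContDiff ℝ (⊤ : ℕ∞) F) (hM : ∀ y, y ∈ M ↔ F y = 0)
    (hsurj : ∀ y ∈ M, Function.Surjective (fderiv ℝ F y))
    (hd : d + Module.finrank ℝ W = Module.finrank ℝ V) : IsSmoothSubmanifold d M := by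
  let L : W ≃L[ℝ] (Fin (Module.finrank ℝ W) → ℝ) :=
    ContinuousLinearEquiv.ofFinrankEq (by simp)
  refine ⟨_, hd, fun x _ => ⟨univ, L ∘ F, isOpen_univ, mem_univ _,
    (L.contDiff.comp hF).contDiffOn, fun y _ => ?_, fun y hy => ?_⟩⟩
  · rw [hM, Function.comp_apply, L.map_eq_zero_iff]
  · rw [L.comp_fderiv]
    exact L.surjective.comp (hsurj y hy.2)

/-- Moving along z changes φ and not f. This upgrades surjectivity of f to surjectivity of the pair
(f, φ). -/
theorem exists_prod_value {V W : Type*} [AddCommGroup V] [Module ℝ V] [AddCommGroup W] [Module ℝ W]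
    (f : V →ₗ[ℝ] W) (φ : V →ₗ[ℝ] ℝ) {z : V} (hf : f z = 0) (hφ : φ z ≠ 0) (x : V) (c : ℝ) :
    ∃ y, f y = f x ∧ φ y = c := by
  refine ⟨x + ((c - φ x) / φ z) • z, ?_, ?_⟩
  · rw [map_add, map_smul, hf, smul_zero, add_zero]
  · rw [map_add, map_smul, smul_eq_mul, div_mul_cancel₀ _ hφ, add_sub_cancel]

/-! ### The equations of the compact symplectic group -/

section Equations

variable {l : Type*} [Fintype l] [DecidableEq l]

/-- The projection of the complex matrices onto the quaternionic ones. -/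
noncomputable def quatProj (l : Type*) [Fintype l] [DecidableEq l] :
    Matrix (l ⊕ l) (l ⊕ l) ℂ →ₗ[ℝ] Matrix (l ⊕ l) (l ⊕ l) ℂ where
  toFun A := (1 / 2 : ℝ) • (A - Matrix.J l ℂ * A.map (starRingEnd ℂ) * Matrix.J l ℂ)
  map_add' A B := by
    rw [Matrix.map_add _ (map_add _), Matrix.mul_add, Matrix.add_mul, ← smul_add]
    congr 1
    abel
  map_smul' c A := by
    have : (c • A).map (starRingEnd ℂ) = c • A.map (starRingEnd ℂ) := by ext i j; simp
    rw [this, Matrix.mul_smul, Matrix.smul_mul, ← smul_sub, smul_comm]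
    rfl

theorem quatProj_apply (A : Matrix (l ⊕ l) (l ⊕ l) ℂ) : quatProj l A =
    (1 / 2 : ℝ) • (A - Matrix.J l ℂ * A.map (starRingEnd ℂ) * Matrix.J l ℂ) := rfl

theorem isQuat_iff_mul_mul {A : Matrix (l ⊕ l) (l ⊕ l) ℂ} :
    IsQuat A ↔ Matrix.J l ℂ * A.map (starRingEnd ℂ) * Matrix.J l ℂ = -A := by
  have hJ := Matrix.J_squared l ℂ
  constructor
  · intro h
    rw [← h, Matrix.mul_assoc, hJ, Matrix.mul_neg, Matrix.mul_one]
  · intro h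
    have h1 := congrArg (· * Matrix.J l ℂ) h
    simp only [Matrix.mul_assoc, hJ, Matrix.mul_neg, Matrix.mul_one, Matrix.neg_mul, neg_inj] at h1
    exact h1.symm

theorem quatProj_eq_self_iff {A : Matrix (l ⊕ l) (l ⊕ l) ℂ} : quatProj l A = A ↔ IsQuat A := by
  rw [isQuat_iff_mul_mul, quatProj_apply]
  constructor
  · intro h
    have h1 := congrArg ((2 : ℝ) • ·) h
    simp only [smul_smul] at h1
    norm_num at h1
    rw [two_smul, sub_eq_iff_eq_add, add_assoc, left_eq_add] at h1
    exact eq_neg_of_add_eq_zero_right h1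
  · intro h
    rw [h, sub_neg_eq_add, ← two_smul ℝ, smul_smul]
    norm_num

theorem isQuat_quatProj (A : Matrix (l ⊕ l) (l ⊕ l) ℂ) : IsQuat (quatProj l A) := by
  have hJ := Matrix.J_squared l ℂ
  rw [quatProj_apply]
  refine IsQuat.smul ?_ _
  rw [isQuat_iff_mul_mul, Matrix.map_sub _ (map_sub _), Matrix.map_mul, Matrix.map_mul,
    Matrix.map_J, map_conj_map_conj, Matrix.mul_sub, Matrix.sub_mul]
  have h : Matrix.J l ℂ * (Matrix.J l ℂ * A * Matrix.J l ℂ) * Matrix.J l ℂ = A := by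
    calc _ = (Matrix.J l ℂ * Matrix.J l ℂ) * A * (Matrix.J l ℂ * Matrix.J l ℂ) := by
          simp only [Matrix.mul_assoc]
      _ = A := by rw [hJ]; simp
  rw [h]
  abel

/-- Quaternionic Q commutes with the structure A ↦ −JĀJ whose fixed part `quatProj` extracts. -/
theorem quatProj_mul {Q : Matrix (l ⊕ l) (l ⊕ l) ℂ} (hQ : IsQuat Q)
    (A : Matrix (l ⊕ l) (l ⊕ l) ℂ) : quatProj l (Q * A) = Q * quatProj l A := by
  rw [quatProj_apply, quatProj_apply, Matrix.map_mul, Matrix.mul_smul, Matrix.mul_sub,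
    ← Matrix.mul_assoc (Matrix.J l ℂ), ← hQ]
  simp only [Matrix.mul_assoc]

theorem quatProj_conjTranspose (A : Matrix (l ⊕ l) (l ⊕ l) ℂ) :
    quatProj l Aᴴ = (quatProj l A)ᴴ := by
  have h : Aᴴ.map (starRingEnd ℂ) = (A.map (starRingEnd ℂ))ᴴ := by ext i j; simp
  rw [quatProj_apply, quatProj_apply, Matrix.conjTranspose_smul, Matrix.conjTranspose_sub,
    Matrix.conjTranspose_mul, Matrix.conjTranspose_mul, J_conjTranspose, h]
  simp [Matrix.mul_assoc]

/-- The projection of the complex matrices onto the quaternionic hermitian ones. -/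
noncomputable def hermProj (l : Type*) [Fintype l] [DecidableEq l] :
    Matrix (l ⊕ l) (l ⊕ l) ℂ →ₗ[ℝ] Matrix (l ⊕ l) (l ⊕ l) ℂ where
  toFun A := (1 / 2 : ℝ) • (quatProj l A + (quatProj l A)ᴴ)
  map_add' A B := by
    rw [map_add, Matrix.conjTranspose_add, ← smul_add]
    congr 1
    abel
  map_smul' c A := by
    rw [map_smul, Matrix.conjTranspose_smul, star_trivial, ← smul_add, smul_comm]
    rfl

theorem hermProj_apply (A : Matrix (l ⊕ l) (l ⊕ l) ℂ) : hermProj l A =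
    (1 / 2 : ℝ) • (quatProj l A + (quatProj l A)ᴴ) := rfl

theorem isQuat_hermProj (A : Matrix (l ⊕ l) (l ⊕ l) ℂ) : IsQuat (hermProj l A) :=
  ((isQuat_quatProj A).add (isQuat_quatProj A).conjTranspose).smul _

theorem conjTranspose_hermProj (A : Matrix (l ⊕ l) (l ⊕ l) ℂ) :
    (hermProj l A)ᴴ = hermProj l A := by
  rw [hermProj_apply, Matrix.conjTranspose_smul, Matrix.conjTranspose_add,
    Matrix.conjTranspose_conjTranspose, star_trivial, add_comm]

theorem hermProj_of_isQuat {A : Matrix (l ⊕ l) (l ⊕ l) ℂ} (hA : IsQuat A) (hh : Aᴴ = A) :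
    hermProj l A = A := by
  rw [hermProj_apply, quatProj_eq_self_iff.2 hA, hh, ← two_smul ℝ, smul_smul]
  norm_num

theorem hermProj_of_quatProj_eq_zero {A : Matrix (l ⊕ l) (l ⊕ l) ℂ} (hA : quatProj l A = 0) :
    hermProj l A = 0 := by
  rw [hermProj_apply, hA]
  simp

/-- The space of square complex arrays, as a normed space. -/
abbrev MatArray (l : Type*) : Type _ := (l ⊕ l) → (l ⊕ l) → ℂ

/-- The linear part of the equations of the compact symplectic group. -/
noncomputable def linearEq (l : Type*) [Fintype l] [DecidableEq l] :
    MatArray l →ₗ[ℝ] MatArray l :=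
  (Matrix.ofLinearEquiv ℝ).symm.toLinearMap ∘ₗ (LinearMap.id - quatProj l) ∘ₗ
    (Matrix.ofLinearEquiv ℝ).toLinearMap

/-- The projection on the values of the quadratic part of the equations. -/
noncomputable def quadEq (l : Type*) [Fintype l] [DecidableEq l] :
    MatArray l →ₗ[ℝ] MatArray l :=
  (Matrix.ofLinearEquiv ℝ).symm.toLinearMap ∘ₗ hermProj l ∘ₗ
    (Matrix.ofLinearEquiv ℝ).toLinearMap

theorem linearEq_apply (A : MatArray l) :
    Matrix.of (linearEq l A) = Matrix.of A - quatProj l (Matrix.of A) := rfl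

/-- The sesquilinear product `AᴴB` of arrays. -/
noncomputable def gram {l : Type*} [Fintype l] (A B : MatArray l) : MatArray l :=
  Matrix.of.symm ((Matrix.of A)ᴴ * Matrix.of B)

/-- The target of the equations of the compact symplectic group. -/
abbrev EqSpace (l : Type*) [Fintype l] [DecidableEq l] : Type _ :=
  LinearMap.range (linearEq l) × LinearMap.range (quadEq l)

/-- The equations of the compact symplectic group. -/
noncomputable def symplecticEq (l : Type*) [Fintype l] [DecidableEq l] (A : MatArray l) :
    EqSpace l :=
  ((linearEq l).rangeRestrict A,
    (quadEq l).rangeRestrict (gram A A - Matrix.of.symm 1))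

/-- The derivative of the equations of the compact symplectic group. -/
noncomputable def symplecticEqDeriv (A X : MatArray l) : EqSpace l :=
  ((linearEq l).rangeRestrict X, (quadEq l).rangeRestrict (gram A X + gram X A))

theorem contDiff_symplecticEq : ContDiff ℝ (⊤ : ℕ∞) (symplecticEq l) := by
  have h1 : ContDiff ℝ (⊤ : ℕ∞) fun A : MatArray l => gram A A - Matrix.of.symm 1 := by
    refine ContDiff.sub ?_ contDiff_const
    refine contDiff_pi.2 fun i => contDiff_pi.2 fun j => ?_
    change ContDiff ℝ (⊤ : ℕ∞) fun A : MatArray l => ((Matrix.of A)ᴴ * Matrix.of A) i j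
    simp only [Matrix.mul_apply, Matrix.conjTranspose_apply, Matrix.of_apply]
    exact ContDiff.sum fun k _ =>
      (Complex.conjCLE.contDiff.comp (contDiff_apply_apply ℝ ℂ k i)).mul
        (contDiff_apply_apply ℝ ℂ k j)
  exact ((linearEq l).rangeRestrict.toContinuousLinearMap.contDiff).prodMk
    ((quadEq l).rangeRestrict.toContinuousLinearMap.contDiff.comp h1)

omit [DecidableEq l] in
theorem gram_add_smul (A X : MatArray l) (t : ℝ) :
    gram (A + t • X) (A + t • X) = gram A A + t • (gram A X + gram X A) + t ^ 2 • gram X X := by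
  apply Matrix.of.injective
  change (Matrix.of A + t • Matrix.of X)ᴴ * (Matrix.of A + t • Matrix.of X) =
    (Matrix.of A)ᴴ * Matrix.of A + t • ((Matrix.of A)ᴴ * Matrix.of X + (Matrix.of X)ᴴ * Matrix.of A)
      + t ^ 2 • ((Matrix.of X)ᴴ * Matrix.of X)
  simp only [Matrix.conjTranspose_add, Matrix.conjTranspose_smul, star_trivial, Matrix.add_mul,
    Matrix.mul_add, Matrix.smul_mul, Matrix.mul_smul, smul_smul, sq, smul_add]
  abel

/-- Along a line the equations are a quadratic polynomial in t, so the derivative is the coefficient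
of t. -/
theorem fderiv_symplecticEq (A X : MatArray l) :
    fderiv ℝ (symplecticEq l) A X = symplecticEqDeriv A X := by
  have h1 : HasFDerivAt (symplecticEq l) (fderiv ℝ (symplecticEq l) A) A :=
    (contDiff_symplecticEq.differentiable (by simp) A).hasFDerivAt
  have h2 : HasDerivAt (fun t : ℝ => symplecticEq l (A + t • X))
      (fderiv ℝ (symplecticEq l) A X) 0 := h1.hasLineDerivAt X
  have h3 : ∀ t : ℝ, symplecticEq l (A + t • X) = symplecticEq l A + t • symplecticEqDeriv A X +
      t ^ 2 • ((0, (quadEq l).rangeRestrict (gram X X)) : EqSpace l) := by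
    intro t
    refine Prod.ext ?_ ?_
    · simp [symplecticEq, symplecticEqDeriv]
    · simp only [symplecticEq, symplecticEqDeriv, Prod.snd_add, Prod.smul_snd, gram_add_smul,
        ← map_smul, ← map_add]
      congr 1
      abel
  have h4 : HasDerivAt (fun t : ℝ => symplecticEq l (A + t • X)) (symplecticEqDeriv A X) 0 := by
    simp only [h3]
    exact ((((hasDerivAt_id' (0 : ℝ)).smul_const (symplecticEqDeriv A X)).const_add
      (symplecticEq l A)).fun_add (((hasDerivAt_id' (0 : ℝ)).fun_pow 2).smul_const
        ((0, (quadEq l).rangeRestrict (gram X X)) : EqSpace l))).congr_deriv (by simp)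
  exact h2.unique h4

/-- Once A is quaternionic, AᴴA − 1 is already quaternionic hermitian, so projecting it by
`hermProj` loses nothing. The projection only shrinks the target enough for the derivative to be
onto. -/
theorem symplecticEq_eq_zero_iff (A : MatArray l) : symplecticEq l A = 0 ↔
    IsQuat (Matrix.of A) ∧ (Matrix.of A)ᴴ * Matrix.of A = 1 := by
  have h1 : (linearEq l).rangeRestrict A = 0 ↔ IsQuat (Matrix.of A) := by
    rw [← quatProj_eq_self_iff, Subtype.ext_iff]
    change Matrix.of A - quatProj l (Matrix.of A) = 0 ↔ _
    rw [sub_eq_zero, eq_comm]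
  have h2 : (quadEq l).rangeRestrict (gram A A - Matrix.of.symm 1) = 0 ↔
      hermProj l ((Matrix.of A)ᴴ * Matrix.of A - 1) = 0 := by
    rw [Subtype.ext_iff]
    rfl
  rw [symplecticEq, Prod.mk_eq_zero, h1, h2]
  refine and_congr_right fun hq => ?_
  rw [hermProj_of_isQuat ((hq.conjTranspose.mul hq).sub IsQuat.one) (by simp), sub_eq_zero]

/-- The equations are regular along the group. -/
theorem symplecticEqDeriv_surjective {A : MatArray l} (hq : IsQuat (Matrix.of A))
    (hu : (Matrix.of A)ᴴ * Matrix.of A = 1) : Function.Surjective (symplecticEqDeriv A) := by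
  rintro ⟨⟨z, Z₀, rfl⟩, ⟨s, S₀, rfl⟩⟩
  set M := Matrix.of A with hM
  set z := Matrix.of (linearEq l Z₀) with hz
  set s := Matrix.of (quadEq l S₀) with hs
  have hPz : quatProj l z = 0 := by
    rw [hz, linearEq_apply, map_sub, quatProj_eq_self_iff.2 (isQuat_quatProj _), sub_self]
  have hsq : IsQuat s := isQuat_hermProj _
  have hsh : sᴴ = s := conjTranspose_hermProj _
  -- The term z answers the linear equation and is invisible to the quadratic one, since `quatProj`
  -- kills Mᴴz; the term ½Ms is quaternionic, so invisible to the linear one, and contributes ½s +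
  -- ½s.
  refine ⟨Matrix.of.symm (z + (1 / 2 : ℝ) • (M * s)), Prod.ext (Subtype.ext ?_) (Subtype.ext ?_)⟩
  · change (z + (1 / 2 : ℝ) • (M * s)) - quatProj l (z + (1 / 2 : ℝ) • (M * s)) = z
    rw [map_add, hPz, zero_add, quatProj_eq_self_iff.2 ((hq.mul hsq).smul _), add_sub_cancel_right]
  · change hermProj l (Mᴴ * (z + (1 / 2 : ℝ) • (M * s)) + (z + (1 / 2 : ℝ) • (M * s))ᴴ * M) = s
    have h1 : Mᴴ * (z + (1 / 2 : ℝ) • (M * s)) + (z + (1 / 2 : ℝ) • (M * s))ᴴ * M =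
        (Mᴴ * z + (Mᴴ * z)ᴴ) + s := by
      rw [Matrix.mul_add, Matrix.conjTranspose_add, Matrix.add_mul, Matrix.mul_smul,
        ← Matrix.mul_assoc, hu, Matrix.one_mul, Matrix.conjTranspose_smul, Matrix.conjTranspose_mul,
        Matrix.conjTranspose_mul, Matrix.conjTranspose_conjTranspose, hsh, Matrix.smul_mul,
        Matrix.mul_assoc, hu, Matrix.mul_one, star_trivial]
      have h2 : s = (1 / 2 : ℝ) • s + (1 / 2 : ℝ) • s := by rw [← add_smul]; norm_num
      conv_rhs => enter [2]; rw [h2]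
      abel
    have h3 : quatProj l (Mᴴ * z) = 0 := by
      rw [quatProj_mul hq.conjTranspose, hPz, Matrix.mul_zero]
    have h4 : quatProj l (Mᴴ * z + (Mᴴ * z)ᴴ) = 0 := by
      rw [map_add, quatProj_conjTranspose, h3, Matrix.conjTranspose_zero, add_zero]
    rw [h1, map_add, hermProj_of_quatProj_eq_zero h4, zero_add, hermProj_of_isQuat hsq hsh]

/-- Elements of the Lie algebra are tangent to the group. -/
theorem symplecticEqDeriv_tangent {A : MatArray l} (hq : IsQuat (Matrix.of A))
    (hu : (Matrix.of A)ᴴ * Matrix.of A = 1) {T : Matrix (l ⊕ l) (l ⊕ l) ℂ} (hT : IsQuat T)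
    (hs : Tᴴ = -T) : symplecticEqDeriv A (Matrix.of.symm (Matrix.of A * T)) = 0 := by
  refine Prod.ext (Subtype.ext ?_) (Subtype.ext ?_)
  · change Matrix.of A * T - quatProj l (Matrix.of A * T) = 0
    rw [quatProj_eq_self_iff.2 (hq.mul hT), sub_self]
  · change hermProj l ((Matrix.of A)ᴴ * (Matrix.of A * T) + (Matrix.of A * T)ᴴ * Matrix.of A) = 0
    rw [← Matrix.mul_assoc, hu, Matrix.one_mul, Matrix.conjTranspose_mul, Matrix.mul_assoc, hu,
      Matrix.mul_one, hs, add_neg_cancel, map_zero]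

/-- The infinitesimal quaternionic rotation in the plane of `x` and `y`. -/
def rotationGenerator (x y : l ⊕ l → ℂ) : Matrix (l ⊕ l) (l ⊕ l) ℂ :=
  quatCols y * (quatCols x)ᴴ - quatCols x * (quatCols y)ᴴ

theorem isQuat_rotationGenerator (x y : l ⊕ l → ℂ) : IsQuat (rotationGenerator x y) :=
  ((isQuat_quatCols y).mul (isQuat_quatCols x).conjTranspose).sub
    ((isQuat_quatCols x).mul (isQuat_quatCols y).conjTranspose)

theorem conjTranspose_rotationGenerator (x y : l ⊕ l → ℂ) :
    (rotationGenerator x y)ᴴ = -rotationGenerator x y := by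
  simp [rotationGenerator]

theorem conjTranspose_quatCols_mul_apply (x y : l ⊕ l → ℂ) :
    ((quatCols x)ᴴ * quatCols y) (Sum.inl 0) (Sum.inl 0) = star x ⬝ᵥ y := rfl

/-- With q = ⟨y, x⟩ the quaternionic value is 1 − q². Here q is purely imaginary, so −q² = |q|² and
the real part is at least 1. -/
theorem re_dotProduct_rotationGenerator_pos {x y : l ⊕ l → ℂ} (hx : vecNormSq x = 1)
    (hy : vecNormSq y = 1) (hxy : (star y ⬝ᵥ x).re = 0) :
    0 < (star y ⬝ᵥ rotationGenerator x y *ᵥ x).re := by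
  set q := (quatCols y)ᴴ * quatCols x with hq
  have hqq : IsQuat q := (isQuat_quatCols y).conjTranspose.mul (isQuat_quatCols x)
  have h1 : (quatCols y)ᴴ * (rotationGenerator x y * quatCols x) = 1 - q * q := by
    calc (quatCols y)ᴴ * (rotationGenerator x y * quatCols x)
        = ((quatCols y)ᴴ * quatCols y) * ((quatCols x)ᴴ * quatCols x) - q * q := by
          simp only [rotationGenerator, hq, Matrix.sub_mul, Matrix.mul_sub, Matrix.mul_assoc]
      _ = 1 - q * q := by rw [quatCols_gram, quatCols_gram, hx, hy]; simp
  rw [(isQuat_rotationGenerator x y).mul_quatCols] at h1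
  have h2 := congrArg Complex.re (congrFun (congrFun h1 (Sum.inl 0)) (Sum.inl 0))
  rw [conjTranspose_quatCols_mul_apply] at h2
  have hre : (q (Sum.inl 0) (Sum.inl 0)).re = 0 := hxy
  rw [h2, Matrix.sub_apply, Matrix.mul_apply, Fintype.sum_sum_type]
  simp only [Finset.univ_unique, Fin.default_eq_zero, Finset.sum_singleton, hqq.inr_inl,
    Matrix.one_apply_eq, Complex.sub_re, Complex.one_re, Complex.add_re, Complex.mul_re,
    Complex.neg_re, Complex.neg_im, Complex.conj_re, Complex.conj_im, hre]
  nlinarith [sq_nonneg (q (Sum.inl 0) (Sum.inl 0)).im, sq_nonneg (q (Sum.inr 0) (Sum.inl 0)).im,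
    sq_nonneg (q (Sum.inr 0) (Sum.inl 0)).re]

end Equations

/-! ### The hypersurface over an equator -/

theorem mem_equator_iff {n : ℕ} {u x : UnitSphere n} : x ∈ equator u ↔
    (star (u : EuclideanSpace ℂ (Fin n ⊕ Fin n)).ofLp ⬝ᵥ
      (x : EuclideanSpace ℂ (Fin n ⊕ Fin n)).ofLp).re = 0 := by
  rw [equator, mem_ofPred_eq, EuclideanSpace.inner_eq_star_dotProduct, dotProduct_comm]

namespace USp

theorem mem_matSet_univ_iff {n : ℕ} (A : MatArray (Fin n)) :
    A ∈ matSet (univ : Set (USp n)) ↔ symplecticEq (Fin n) A = 0 := by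
  rw [symplecticEq_eq_zero_iff]
  constructor
  · rintro ⟨g, -, rfl⟩
    exact ⟨isQuat g, star_mul_self g⟩
  · rintro ⟨hq, hu⟩
    exact ⟨mk (Matrix.of A) hu hq, mem_univ _, rfl⟩

theorem mem_overEquator_iff {n : ℕ} {u : UnitSphere (n + 1)} {g : USp (n + 1)} :
    g ∈ overEquator u ↔
      (star (u : EuclideanSpace ℂ (Fin (n + 1) ⊕ Fin (n + 1))).ofLp ⬝ᵥ
        mat g *ᵥ lastVec n).re = 0 := by
  rw [overEquator, mem_preimage, mem_equator_iff, proj_ofLp]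

/-- The linear form whose zero set is the hyperplane of the equator. -/
noncomputable def heightForm {n : ℕ} (u : UnitSphere (n + 1)) : MatArray (Fin (n + 1)) →ₗ[ℝ] ℝ where
  toFun A := (star (u : EuclideanSpace ℂ (Fin (n + 1) ⊕ Fin (n + 1))).ofLp ⬝ᵥ
    Matrix.of A *ᵥ lastVec n).re
  map_add' A B := by
    rw [← Matrix.of_add_of, Matrix.add_mulVec, dotProduct_add, Complex.add_re]
  map_smul' c A := by
    rw [← Matrix.smul_of, Matrix.smul_mulVec, dotProduct_smul, Complex.smul_re]
    rfl

/-- The vector iu is real-orthogonal to u. Nonemptiness serves to extract the dimension count from a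
surjective derivative. -/
theorem exists_mem_overEquator {n : ℕ} (u : UnitSphere (n + 1)) : ∃ g, g ∈ overEquator u := by
  have h1 : vecNormSq (Complex.I • (u : EuclideanSpace ℂ (Fin (n + 1) ⊕ Fin (n + 1))).ofLp) = 1 := by
    refine Eq.trans ?_ (UnitSphere.vecNormSq_ofLp u)
    simp [vecNormSq]
  obtain ⟨g, hg⟩ := exists_mulVec_eq (vecNormSq_lastVec n) h1
  refine ⟨g, mem_overEquator_iff.2 ?_⟩
  rw [hg, dotProduct_smul, star_dotProduct_self]
  simp

theorem isSubmanifoldOfCodim_overEquator {n : ℕ} (u : UnitSphere (n + 1)) :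
    IsSubmanifoldOfCodim 1 (overEquator u) := by
  let F := symplecticEq (Fin (n + 1))
  let G : MatArray (Fin (n + 1)) → EqSpace (Fin (n + 1)) × ℝ := fun A => (F A, heightForm u A)
  have hF : ContDiff ℝ (⊤ : ℕ∞) F := contDiff_symplecticEq
  have hℓ : ContDiff ℝ (⊤ : ℕ∞) (heightForm u) :=
    (LinearMap.toContinuousLinearMap (heightForm u)).contDiff
  have hG : ContDiff ℝ (⊤ : ℕ∞) G := hF.prodMk hℓ
  have hMG : ∀ A, A ∈ matSet (overEquator u) ↔ G A = 0 := by
    intro A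
    rw [Prod.mk_eq_zero, ← mem_matSet_univ_iff]
    constructor
    · rintro ⟨g, hg, rfl⟩
      exact ⟨⟨g, mem_univ _, rfl⟩, mem_overEquator_iff.1 hg⟩
    · rintro ⟨⟨g, -, rfl⟩, hg⟩
      exact ⟨g, mem_overEquator_iff.2 hg, rfl⟩
  have hFs : ∀ A ∈ matSet (univ : Set (USp (n + 1))), Function.Surjective (fderiv ℝ F A) := by
    intro A hA w
    obtain ⟨hq, hu⟩ := (symplecticEq_eq_zero_iff A).1 ((mem_matSet_univ_iff A).1 hA)
    obtain ⟨X, hX⟩ := symplecticEqDeriv_surjective hq hu w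
    exact ⟨X, (fderiv_symplecticEq A X).trans hX⟩
  have hGs : ∀ A ∈ matSet (overEquator u), Function.Surjective (fderiv ℝ G A) := by
    intro A hA w
    have hA' : A ∈ matSet (univ : Set (USp (n + 1))) := image_mono (subset_univ _) hA
    obtain ⟨hq, hu⟩ := (symplecticEq_eq_zero_iff A).1 ((mem_matSet_univ_iff A).1 hA')
    have hderiv : ∀ X, fderiv ℝ G A X = (fderiv ℝ F A X, heightForm u X) := by
      intro X
      have h1 : HasFDerivAt F (fderiv ℝ F A) A := (hF.differentiable (by simp) A).hasFDerivAt
      have h2 : HasFDerivAt (heightForm u) (LinearMap.toContinuousLinearMap (heightForm u)) A :=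
        (LinearMap.toContinuousLinearMap (heightForm u)).hasFDerivAt
      rw [(h1.prodMk h2).fderiv]
      rfl
    obtain ⟨X, hX⟩ := hFs A hA' w.1
    -- The height is Re⟨v, ·⟩ at e for v = Aᴴu, a unit vector real-orthogonal to e. The generator
    -- rotating e towards v is a tangent direction that strictly increases it.
    obtain ⟨T, hT, hTs, hpos⟩ : ∃ T, IsQuat T ∧ Tᴴ = -T ∧
        0 < heightForm u (Matrix.of.symm (Matrix.of A * T)) := by
      set v := (Matrix.of A)ᴴ *ᵥ (u : EuclideanSpace ℂ (Fin (n + 1) ⊕ Fin (n + 1))).ofLp with hv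
      have hdot : ∀ y, star v ⬝ᵥ y =
          star (u : EuclideanSpace ℂ (Fin (n + 1) ⊕ Fin (n + 1))).ofLp ⬝ᵥ Matrix.of A *ᵥ y := by
        intro y
        rw [hv, Matrix.star_mulVec, Matrix.conjTranspose_conjTranspose, Matrix.dotProduct_mulVec]
      have hvn : vecNormSq v = 1 := by
        have h1 := star_dotProduct_self v
        rw [hdot, hv, Matrix.mulVec_mulVec, mul_eq_one_comm.1 hu, Matrix.one_mulVec,
          star_dotProduct_self, UnitSphere.vecNormSq_ofLp] at h1
        exact_mod_cast h1.symm
      have hre : (star v ⬝ᵥ lastVec n).re = 0 := by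
        rw [hdot]
        exact (Prod.mk_eq_zero.1 ((hMG A).1 hA)).2
      refine ⟨_, isQuat_rotationGenerator (lastVec n) v, conjTranspose_rotationGenerator _ _, ?_⟩
      have h := re_dotProduct_rotationGenerator_pos (vecNormSq_lastVec n) hvn hre
      rw [hdot, Matrix.mulVec_mulVec] at h
      exact h
    set Z := Matrix.of.symm (Matrix.of A * T) with hZ
    have hFZ : fderiv ℝ F A Z = 0 :=
      (fderiv_symplecticEq A Z).trans (symplecticEqDeriv_tangent hq hu hT hTs)
    obtain ⟨X', h1, h2⟩ := exists_prod_value (fderiv ℝ F A).toLinearMap (heightForm u) hFZ hpos.ne'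
      X w.2
    exact ⟨X', (hderiv X').trans (Prod.ext (h1.trans hX) h2)⟩
  obtain ⟨g, hg⟩ := exists_mem_overEquator u
  -- The dimension of the group is never computed: surjectivity of the derivative at one point
  -- leaves room for the extra equation, and d is the difference.
  have hle : Module.finrank ℝ (EqSpace (Fin (n + 1))) + 1 ≤
      Module.finrank ℝ (MatArray (Fin (n + 1))) := by
    have h := LinearMap.finrank_le_finrank_of_surjective
      (f := (fderiv ℝ G (fun i j => mat g i j)).toLinearMap) (hGs _ ⟨g, hg, rfl⟩)
    rwa [Module.finrank_prod, Module.finrank_self] at h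
  obtain ⟨d, hd⟩ := Nat.exists_eq_add_of_le' hle
  have hd1 : d + 1 + Module.finrank ℝ (EqSpace (Fin (n + 1))) =
      Module.finrank ℝ (MatArray (Fin (n + 1))) := by omega
  have hd2 : d + Module.finrank ℝ (EqSpace (Fin (n + 1)) × ℝ) =
      Module.finrank ℝ (MatArray (Fin (n + 1))) := by
    rw [Module.finrank_prod, Module.finrank_self]
    omega
  exact ⟨d, isSmoothSubmanifold_of_regular hF mem_matSet_univ_iff hFs hd1,
    isSmoothSubmanifold_of_regular hG hMG hGs hd2⟩

end USp

/-! ### Second moments for the invariant measure -/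

namespace USp

instance instIsHaarMeasure (n : ℕ) : (invariantMeasure n).IsHaarMeasure := by
  unfold invariantMeasure
  infer_instance

theorem invariantMeasure_univ (n : ℕ) : invariantMeasure n univ = 1 := by
  have h := Measure.haarMeasure_self (K₀ := (⊤ : TopologicalSpace.PositiveCompacts (USp n)))
  rwa [TopologicalSpace.PositiveCompacts.coe_top] at h

instance instIsProbabilityMeasure (n : ℕ) : IsProbabilityMeasure (invariantMeasure n) :=
  ⟨invariantMeasure_univ n⟩

theorem integrable_of_continuous {n : ℕ} {f : USp n → ℝ} (hf : Continuous f) :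
    Integrable f (invariantMeasure n) :=
  hf.integrable_of_hasCompactSupport (HasCompactSupport.of_compactSpace f)

variable {n : ℕ}

theorem vecNormSq_mulVec (g : USp n) (x : Fin n ⊕ Fin n → ℂ) :
    vecNormSq (mat g *ᵥ x) = vecNormSq x := by
  have h : (vecNormSq (mat g *ᵥ x) : ℂ) = vecNormSq x := by
    rw [← star_dotProduct_self, ← star_dotProduct_self, Matrix.star_mulVec, Matrix.dotProduct_mulVec,
      Matrix.vecMul_vecMul, star_mul_self, Matrix.vecMul_one]
  exact_mod_cast h

theorem continuous_normSq_dotProduct (u x : Fin n ⊕ Fin n → ℂ) :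
    Continuous fun g : USp n => Complex.normSq (star u ⬝ᵥ mat g *ᵥ x) :=
  Complex.continuous_normSq.comp
    (continuous_const.dotProduct (continuous_mat.matrix_mulVec continuous_const))

/-- The second moment of a matrix coefficient depends only on the norm of the left vector. -/
theorem integral_normSq_mulVec (h : USp n) (u x : Fin n ⊕ Fin n → ℂ) :
    ∫ g, Complex.normSq (star (mat h *ᵥ u) ⬝ᵥ mat g *ᵥ x) ∂invariantMeasure n =
      ∫ g, Complex.normSq (star u ⬝ᵥ mat g *ᵥ x) ∂invariantMeasure n := by
  rw [← integral_mul_left_eq_self (fun g => Complex.normSq (star u ⬝ᵥ mat g *ᵥ x)) h⁻¹]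
  congr 1
  funext g
  rw [mat_mul, mat_inv, ← Matrix.mulVec_mulVec, Matrix.star_mulVec, ← Matrix.dotProduct_mulVec]

theorem vecNormSq_single (i : Fin n ⊕ Fin n) : vecNormSq (Pi.single i (1 : ℂ)) = 1 := by
  rw [vecNormSq, Finset.sum_eq_single i]
  · simp
  · intro j _ hj
    simp [Pi.single_eq_of_ne hj]
  · simp

/-- Transitivity and left invariance give all 2n coordinates of gx the same second moment as ⟨u,
gx⟩, and their squares sum to |gx|² = 1. -/
theorem integral_normSq_dotProduct {u x : Fin n ⊕ Fin n → ℂ} (hu : vecNormSq u = 1)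
    (hx : vecNormSq x = 1) :
    2 * n * ∫ g, Complex.normSq (star u ⬝ᵥ mat g *ᵥ x) ∂invariantMeasure n = 1 := by
  have h1 : ∀ i : Fin n ⊕ Fin n,
      ∫ g, Complex.normSq ((mat g *ᵥ x) i) ∂invariantMeasure n =
        ∫ g, Complex.normSq (star u ⬝ᵥ mat g *ᵥ x) ∂invariantMeasure n := by
    intro i
    obtain ⟨h, hh⟩ := exists_mulVec_eq hu (vecNormSq_single i)
    rw [← integral_normSq_mulVec h, hh]
    congr 1
    funext g
    rw [← Pi.single_star, star_one, single_one_dotProduct]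
  have hc : ∀ i : Fin n ⊕ Fin n, Continuous fun g : USp n => Complex.normSq ((mat g *ᵥ x) i) :=
    fun i => Complex.continuous_normSq.comp
      ((continuous_apply i).comp (continuous_mat.matrix_mulVec continuous_const))
  have h2 : ∫ g, vecNormSq (mat g *ᵥ x) ∂invariantMeasure n = 1 := by
    simp [vecNormSq_mulVec, hx]
  unfold vecNormSq at h2
  rw [integral_finsetSum _ fun i _ => integrable_of_continuous (hc i)] at h2
  simp only [h1, Finset.sum_const, Finset.card_univ, Fintype.card_sum, Fintype.card_fin,
    nsmul_eq_mul] at h2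
  rw [← h2]
  push_cast
  ring

/-- The quaternionic hermitian product of `u` and of the image of the last vector. -/
noncomputable def quatCoeff {n : ℕ} (u : Fin (n + 1) ⊕ Fin (n + 1) → ℂ) (g : USp (n + 1)) :
    Matrix (Fin 1 ⊕ Fin 1) (Fin 1 ⊕ Fin 1) ℂ :=
  (quatCols u)ᴴ * quatCols (mat g *ᵥ lastVec n)

theorem quatNormSq_quatCoeff (u : Fin (n + 1) ⊕ Fin (n + 1) → ℂ) (g : USp (n + 1)) :
    quatNormSq (quatCoeff u g) = Complex.normSq (star u ⬝ᵥ mat g *ᵥ lastVec n) +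
      Complex.normSq (star (Matrix.J _ ℂ *ᵥ star u) ⬝ᵥ mat g *ᵥ lastVec n) := rfl

theorem vecNormSq_J_mulVec_star {l : Type*} [Fintype l] [DecidableEq l] (u : l ⊕ l → ℂ) :
    vecNormSq (Matrix.J l ℂ *ᵥ star u) = vecNormSq u := by
  simp only [vecNormSq, J_mulVec, Fintype.sum_sum_type, Sum.elim_inl, Sum.elim_inr,
    Complex.normSq_neg, Pi.star_apply, Complex.star_def, Complex.normSq_conj]
  exact add_comm _ _

theorem continuous_quatNormSq_quatCoeff (u : Fin (n + 1) ⊕ Fin (n + 1) → ℂ) :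
    Continuous fun g : USp (n + 1) => quatNormSq (quatCoeff u g) :=
  (continuous_normSq_dotProduct _ _).add (continuous_normSq_dotProduct _ _)

/-- The quaternion has two complex coefficients, against the unit vectors u and Jū, each of second
moment 1/(2(n+1)). -/
theorem integral_quatNormSq_quatCoeff {u : Fin (n + 1) ⊕ Fin (n + 1) → ℂ} (hu : vecNormSq u = 1) :
    ∫ g, quatNormSq (quatCoeff u g) ∂invariantMeasure (n + 1) = 1 / ((n : ℝ) + 1) := by
  simp only [quatNormSq_quatCoeff]
  rw [integral_add (integrable_of_continuous (continuous_normSq_dotProduct _ _))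
    (integrable_of_continuous (continuous_normSq_dotProduct _ _))]
  have h1 := integral_normSq_dotProduct hu (vecNormSq_lastVec n)
  have h2 := integral_normSq_dotProduct ((vecNormSq_J_mulVec_star u).trans hu) (vecNormSq_lastVec n)
  push_cast at h1 h2
  have hn : (n : ℝ) + 1 ≠ 0 := by positivity
  rw [eq_div_iff hn]
  linear_combination (1 / 2) * h1 + (1 / 2) * h2

theorem measure_le_quatNormSq_le {u : Fin (n + 1) ⊕ Fin (n + 1) → ℂ} (hu : vecNormSq u = 1)
    {c : ℝ} (hc : 0 < c) :
    invariantMeasure (n + 1) {g | c ≤ quatNormSq (quatCoeff u g)} ≤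
      ENNReal.ofReal (1 / ((n : ℝ) + 1) / c) := by
  have h := mul_meas_ge_le_integral_of_nonneg (μ := invariantMeasure (n + 1))
    (f := fun g => quatNormSq (quatCoeff u g))
    (Eventually.of_forall fun g => add_nonneg (Complex.normSq_nonneg _) (Complex.normSq_nonneg _))
    (integrable_of_continuous (continuous_quatNormSq_quatCoeff u)) c
  rw [integral_quatNormSq_quatCoeff hu, mul_comm, ← le_div_iff₀ hc] at h
  exact (ENNReal.le_ofReal_iff_toReal_le (measure_ne_top _ _) (by positivity)).2 h

end USp

/-! ### Rotating a point into the hypersurface -/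

theorem exists_rotation_parameter {a p : ℝ} (hp : 1 / 2 ≤ p) (hp1 : p ≤ 1) :
    ∃ s : ℝ, (1 - s ^ 2 * p) * a + 2 * s * p = 0 ∧ |s| * Real.sqrt p ≤ |a| := by
  set R := Real.sqrt (p ^ 2 + a ^ 2 * p) with hR
  have hp0 : 0 < p := by linarith
  have hR2 : R ^ 2 = p ^ 2 + a ^ 2 * p := Real.sq_sqrt (by positivity)
  have hRp : p ≤ R := Real.le_sqrt_of_sq_le (by nlinarith [mul_nonneg (sq_nonneg a) hp0.le])
  have hD : 0 < p + R := by linarith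
  -- The smaller root of aps² − 2ps − a = 0, rationalised so as to cover a = 0. The denominator is
  -- at least 2p ≥ 1, which gives the bound on |s|.
  refine ⟨-a / (p + R), ?_, ?_⟩
  · field_simp
    linear_combination a * hR2
  · rw [abs_div, abs_neg, abs_of_pos hD, div_mul_eq_mul_div, div_le_iff₀ hD]
    have h1 : Real.sqrt p ≤ 1 := Real.sqrt_le_one.2 hp1
    gcongr
    linarith

section Rotation

variable {l : Type*} [Fintype l] [DecidableEq l] {x v : l ⊕ l → ℂ} {p : ℝ}

theorem frob_mul_conjTranspose_quatCols (hx : vecNormSq x = 1) (hv : vecNormSq v = p) :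
    frob (quatCols v * (quatCols x)ᴴ) = Real.sqrt (2 * p) := by
  rw [frob, frobSq_eq_re_trace]
  congr 1
  have h : (quatCols v * (quatCols x)ᴴ)ᴴ * (quatCols v * (quatCols x)ᴴ) =
      p • (quatCols x * (quatCols x)ᴴ) := by
    calc _ = quatCols x * ((quatCols v)ᴴ * quatCols v) * (quatCols x)ᴴ := by
          rw [Matrix.conjTranspose_mul, Matrix.conjTranspose_conjTranspose]
          simp only [Matrix.mul_assoc]
      _ = _ := by rw [quatCols_gram, hv, Matrix.mul_smul, Matrix.mul_one, Matrix.smul_mul]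
  rw [h, Matrix.trace_smul, Matrix.trace_mul_comm, quatCols_gram, hx, one_smul, Matrix.trace_one]
  simp
  ring

/-- Each of the two terms of the generator has Frobenius norm √(2p). -/
theorem frob_rotationGenerator_le (hx : vecNormSq x = 1) (hv : vecNormSq v = p) (s : ℝ) :
    frob (s • rotationGenerator x v) ≤ 2 * Real.sqrt 2 * (|s| * Real.sqrt p) := by
  have h1 := frob_mul_conjTranspose_quatCols hx hv
  have h2 : frob (-(quatCols x * (quatCols v)ᴴ)) = Real.sqrt (2 * p) := by
    rw [← h1, ← neg_one_smul ℝ, frob_smul, frob, ← frobSq_conjTranspose]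
    simp [frob]
  have h3 := frob_add_le (quatCols v * (quatCols x)ᴴ) (-(quatCols x * (quatCols v)ᴴ))
  rw [h1, h2, ← sub_eq_add_neg, Real.sqrt_mul two_pos.le] at h3
  rw [frob_smul, rotationGenerator]
  nlinarith [mul_le_mul_of_nonneg_left h3 (abs_nonneg s)]

/-- When v is quaternionically orthogonal to x, Y sends x to sv and v to −spx, so its Cayley
transform is the rational parametrisation of a rotation in their plane, here with denominator
cleared. -/
theorem cayley_rotationGenerator_mul_quatCols (hx : vecNormSq x = 1) (hv : vecNormSq v = p)
    (hxv : (quatCols v)ᴴ * quatCols x = 0) {s : ℝ}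
    (hY : (s • rotationGenerator x v)ᴴ = -(s • rotationGenerator x v)) :
    (1 + s ^ 2 * p) • (cayley (s • rotationGenerator x v) 1 * quatCols x) =
      (1 - s ^ 2 * p) • quatCols x + (2 * s) • quatCols v := by
  set Y := s • rotationGenerator x v with hYd
  have hvx : (quatCols x)ᴴ * quatCols v = 0 := by
    have h := congrArg (fun A => Aᴴ) hxv
    simpa using h
  have h1 : Y * quatCols x = s • quatCols v := by
    rw [hYd, Matrix.smul_mul, rotationGenerator, Matrix.sub_mul, Matrix.mul_assoc, Matrix.mul_assoc,
      hxv, quatCols_gram, hx, one_smul, Matrix.mul_one, Matrix.mul_zero, sub_zero]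
  have h2 : Y * quatCols v = -(s * p) • quatCols x := by
    rw [hYd, Matrix.smul_mul, rotationGenerator, Matrix.sub_mul, Matrix.mul_assoc, Matrix.mul_assoc,
      hvx, quatCols_gram, hv, Matrix.mul_zero, Matrix.mul_smul, Matrix.mul_one, zero_sub, smul_neg,
      smul_smul, neg_smul]
  -- The vector x + sv is, up to a scalar, (1 − Y)⁻¹x.
  have h3 : (1 - (1 : ℝ) • Y) * (quatCols x + s • quatCols v) = (1 + s ^ 2 * p) • quatCols x := by
    rw [one_smul, Matrix.sub_mul, Matrix.one_mul, Matrix.mul_add, Matrix.mul_smul, h1, h2]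
    module
  have h4 : (1 + (1 : ℝ) • Y) * (quatCols x + s • quatCols v) =
      (1 - s ^ 2 * p) • quatCols x + (2 * s) • quatCols v := by
    rw [one_smul, Matrix.add_mul, Matrix.one_mul, Matrix.mul_add, Matrix.mul_smul, h1, h2]
    module
  rw [← h4, ← Matrix.mul_smul, ← h3, ← Matrix.mul_assoc, cayley_mul hY]

end Rotation

namespace USp

variable {n : ℕ}

/-- Write gᴴu = e·qᴴ + v with v quaternionically orthogonal to e and |v|² = 1 − ρ. Rotating e
towards v turns the height a = Re q into ((1 − s²p)a + 2sp)/(1 + s²p) with p = 1 − ρ, and s is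
chosen to annihilate it. -/
theorem exists_mem_overEquator_riemannianDist_le (u : UnitSphere (n + 1)) (g : USp (n + 1))
    (hg : quatNormSq (quatCoeff (u : EuclideanSpace ℂ (Fin (n + 1) ⊕ Fin (n + 1))).ofLp g) ≤ 1 / 2) :
    ∃ s ∈ overEquator u, riemannianDist g s ≤ ENNReal.ofReal (4 * Real.sqrt
      (quatNormSq (quatCoeff (u : EuclideanSpace ℂ (Fin (n + 1) ⊕ Fin (n + 1))).ofLp g))) := by
  set w := (u : EuclideanSpace ℂ (Fin (n + 1) ⊕ Fin (n + 1))).ofLp with hw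
  have hwn : vecNormSq w = 1 := UnitSphere.vecNormSq_ofLp u
  set q := quatCoeff w g with hq
  set ρ := quatNormSq q with hρ
  have hx := vecNormSq_lastVec n
  set E := quatCols (lastVec n) with hE
  have hEE : Eᴴ * E = 1 := by rw [hE, quatCols_gram, hx, one_smul]
  set V₀ := (mat g)ᴴ * quatCols w with hV₀
  have hV₀V₀ : V₀ᴴ * V₀ = 1 := by
    rw [hV₀, Matrix.conjTranspose_mul, Matrix.conjTranspose_conjTranspose, Matrix.mul_assoc,
      ← Matrix.mul_assoc (mat g), mul_star_self, Matrix.one_mul, quatCols_gram, hwn, one_smul]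
  have hV₀E : V₀ᴴ * E = q := by
    rw [hV₀, Matrix.conjTranspose_mul, Matrix.conjTranspose_conjTranspose, Matrix.mul_assoc, hE,
      (isQuat g).mul_quatCols]
    rfl
  have hEV₀ : Eᴴ * V₀ = qᴴ := by rw [← hV₀E]; simp
  have hqq : IsQuat q := (isQuat_quatCols _).conjTranspose.mul (isQuat_quatCols _)
  obtain ⟨v, hv⟩ : ∃ v, quatCols v = V₀ - E * qᴴ :=
    ⟨_, (IsQuat.eq_quatCols (((isQuat g).conjTranspose.mul (isQuat_quatCols w)).sub
      ((isQuat_quatCols _).mul hqq.conjTranspose))).symm⟩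
  have hEV : Eᴴ * quatCols v = 0 := by
    rw [hv, Matrix.mul_sub, ← Matrix.mul_assoc Eᴴ E, hEE, Matrix.one_mul, hEV₀, sub_self]
  have hVE : (quatCols v)ᴴ * E = 0 := by
    have h := congrArg (fun A => Aᴴ) hEV
    simpa using h
  have hV₀V : V₀ᴴ * quatCols v =
      (1 - ρ) • (1 : Matrix (Fin 1 ⊕ Fin 1) (Fin 1 ⊕ Fin 1) ℂ) := by
    rw [hv, Matrix.mul_sub, hV₀V₀, ← Matrix.mul_assoc, hV₀E, hqq.mul_conjTranspose_self, sub_smul,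
      one_smul]
  have hvn : vecNormSq v = 1 - ρ := by
    have h1 : (quatCols v)ᴴ * quatCols v =
        (1 - ρ) • (1 : Matrix (Fin 1 ⊕ Fin 1) (Fin 1 ⊕ Fin 1) ℂ) := by
      conv_lhs => enter [1]; rw [hv]
      rw [Matrix.conjTranspose_sub, Matrix.conjTranspose_mul E, Matrix.conjTranspose_conjTranspose,
        Matrix.sub_mul, Matrix.mul_assoc q, hEV, Matrix.mul_zero, sub_zero, hV₀V]
    rw [quatCols_gram] at h1
    have h2 := congrArg Complex.re (congrFun (congrFun h1 (Sum.inl 0)) (Sum.inl 0))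
    simpa using h2
  have hρ0 : 0 ≤ ρ := add_nonneg (Complex.normSq_nonneg _) (Complex.normSq_nonneg _)
  set a := (q (Sum.inl 0) (Sum.inl 0)).re with ha
  have haρ : |a| ≤ Real.sqrt ρ := by
    refine Real.abs_le_sqrt ?_
    rw [hρ, quatNormSq, Complex.normSq_apply, sq]
    linarith [mul_self_nonneg (q (Sum.inl 0) (Sum.inl 0)).im,
      Complex.normSq_nonneg (q (Sum.inr 0) (Sum.inl 0))]
  obtain ⟨s, hs, hsa⟩ := exists_rotation_parameter (a := a) (p := 1 - ρ) (by linarith) (by linarith)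
  have hYq : IsQuat (s • rotationGenerator (lastVec n) v) := (isQuat_rotationGenerator _ _).smul s
  have hY : (s • rotationGenerator (lastVec n) v)ᴴ = -(s • rotationGenerator (lastVec n) v) := by
    rw [Matrix.conjTranspose_smul, conjTranspose_rotationGenerator, star_trivial, smul_neg]
  set Y := s • rotationGenerator (lastVec n) v with hYd
  refine ⟨g * mk (cayley Y 1) (cayley_unitary hY 1) (isQuat_cayley hY hYq 1), ?_, ?_⟩
  · rw [mem_overEquator_iff, mat_mul, mat_mk, ← hw, ← Matrix.mulVec_mulVec]
    have h1 : (quatCols w)ᴴ * quatCols (mat g *ᵥ cayley Y 1 *ᵥ lastVec n) =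
        V₀ᴴ * (cayley Y 1 * E) := by
      rw [← (isQuat g).mul_quatCols, ← (isQuat_cayley hY hYq 1).mul_quatCols, hV₀,
        Matrix.conjTranspose_mul, Matrix.conjTranspose_conjTranspose, Matrix.mul_assoc]
    have h2 : (1 + s ^ 2 * (1 - ρ)) • (V₀ᴴ * (cayley Y 1 * E)) = (1 - s ^ 2 * (1 - ρ)) • q +
        (2 * s * (1 - ρ)) • (1 : Matrix (Fin 1 ⊕ Fin 1) (Fin 1 ⊕ Fin 1) ℂ) := by
      rw [← Matrix.mul_smul, hE, cayley_rotationGenerator_mul_quatCols hx hvn hVE hY,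
        Matrix.mul_add, Matrix.mul_smul, Matrix.mul_smul, hV₀V, ← hE, hV₀E, smul_smul]
    rw [← h1] at h2
    have h3 := congrArg Complex.re (congrFun (congrFun h2 (Sum.inl 0)) (Sum.inl 0))
    rw [Matrix.smul_apply, conjTranspose_quatCols_mul_apply, Matrix.add_apply, Matrix.smul_apply,
      Matrix.smul_apply, Complex.smul_re, Complex.add_re, Complex.smul_re, Complex.smul_re,
      Matrix.one_apply_eq, Complex.one_re, smul_eq_mul, smul_eq_mul, smul_eq_mul, mul_one, ← ha,
      hs] at h3
    have h4 : (1 + s ^ 2 * (1 - ρ)) ≠ 0 := by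
      have : 0 ≤ s ^ 2 * (1 - ρ) := mul_nonneg (sq_nonneg s) (by linarith)
      linarith
    exact (mul_eq_zero.1 h3).resolve_left h4
  · refine (riemannianDist_mul_cayley_le g hY hYq).trans (ENNReal.ofReal_le_ofReal ?_)
    -- The constant 4: the distance is at most 2|Y|/√2, where |Y| ≤ 2√2·|s|√p and |s|√p ≤ |a| ≤ √ρ.
    rw [div_le_iff₀ (by positivity)]
    have h1 := frob_rotationGenerator_le hx hvn s
    rw [← hYd] at h1
    have h2 : Real.sqrt 2 * (|s| * Real.sqrt (1 - ρ)) ≤ Real.sqrt 2 * Real.sqrt ρ :=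
      mul_le_mul_of_nonneg_left (hsa.trans haρ) (Real.sqrt_nonneg 2)
    linarith

/-- Points with ρ < c lie within 4√c of the hypersurface, so the complement of the tube is contained
in {ρ ≥ c}, to which Markov's inequality applies. -/
theorem measure_compl_tube_le (u : UnitSphere (n + 1)) {c : ℝ} (hc : 0 < c) (hc2 : c ≤ 1 / 2) :
    invariantMeasure (n + 1) (tube riemannianDist (overEquator u) (4 * Real.sqrt c))ᶜ ≤
      ENNReal.ofReal (1 / ((n : ℝ) + 1) / c) := by
  refine (measure_mono fun g hg => ?_).trans
    (measure_le_quatNormSq_le (UnitSphere.vecNormSq_ofLp u) hc)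
  rw [mem_ofPred_eq]
  by_contra h
  push Not at h
  obtain ⟨s, hs, hd⟩ := exists_mem_overEquator_riemannianDist_le u g (h.le.trans hc2)
  refine hg ⟨s, hs, hd.trans_lt ((ENNReal.ofReal_lt_ofReal_iff (by positivity)).2 ?_)⟩
  gcongr
  exact add_nonneg (Complex.normSq_nonneg _) (Complex.normSq_nonneg _)

/-! ### Closed proper hypersurfaces and the limit -/

theorem isClosed_overEquator (u : UnitSphere (n + 1)) : IsClosed (overEquator u) := by
  have h : overEquator u = {g | (star (u : EuclideanSpace ℂ (Fin (n + 1) ⊕ Fin (n + 1))).ofLp ⬝ᵥ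
      mat g *ᵥ lastVec n).re = 0} := by
    ext g
    exact mem_overEquator_iff
  rw [h]
  exact isClosed_eq (Complex.continuous_re.comp
    (continuous_const.dotProduct (continuous_mat.matrix_mulVec continuous_const))) continuous_const

theorem overEquator_ne_univ (u : UnitSphere (n + 1)) : overEquator u ≠ univ := by
  intro h
  obtain ⟨g, hg⟩ := proj_surjective n u
  have h1 : g ∈ overEquator u := h ▸ mem_univ g
  rw [mem_overEquator_iff, ← proj_ofLp, hg, star_dotProduct_self, UnitSphere.vecNormSq_ofLp] at h1
  simp at h1

theorem concentratesOn_overEquator (u : ∀ n : ℕ, UnitSphere (n + 1)) :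
    ConcentratesOn (fun n => USp (n + 1)) (fun _ => riemannianDist)
      (fun n => invariantMeasure (n + 1)) (fun n => overEquator (u n)) where
  connected _ := inferInstance
  metric n := isCompatibleMetric_riemannianDist (n + 1)
  measurable_of_isOpen _ _ hU := hU.measurableSet
  measure_ne_zero n _ hU hne := hU.measure_ne_zero (invariantMeasure (n + 1)) hne
  normalized n := invariantMeasure_univ (n + 1)
  isClosed n := isClosed_overEquator (u n)
  proper n := overEquator_ne_univ (u n)
  concentrates := by
    -- Take c = t/2, which is at most 1/2 as t ≤ 1: the radius 4√(t/2) tends to 0, and the measure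
    -- bound is t²/(t/2) = 2t.
    set t : ℕ → ℝ := fun n => Real.sqrt (1 / ((n : ℝ) + 1)) with ht
    have ht0 : ∀ n, 0 < t n := fun n => Real.sqrt_pos.2 (by positivity)
    have ht1 : ∀ n, t n ≤ 1 := fun n => Real.sqrt_le_one.2 (by
      rw [div_le_one (by positivity)]
      linarith [Nat.cast_nonneg (α := ℝ) n])
    have ht2 : ∀ n : ℕ, 1 / ((n : ℝ) + 1) = t n ^ 2 := fun n => (Real.sq_sqrt (by positivity)).symm
    have htt : Tendsto t atTop (𝓝 0) := by
      have h := (Real.continuous_sqrt.tendsto 0).comp (tendsto_one_div_add_atTop_nhds_zero_nat (𝕜 := ℝ))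
      rwa [Real.sqrt_zero] at h
    refine ⟨fun n => 4 * Real.sqrt (t n / 2), fun n => ?_, ?_, ?_⟩
    · have := ht0 n
      positivity
    · have h := ((Real.continuous_sqrt.tendsto _).comp (htt.div_const 2)).const_mul 4
      simpa using h
    · have h : Tendsto (fun n => ENNReal.ofReal (2 * t n)) atTop (𝓝 0) := by
        have h1 := ENNReal.tendsto_ofReal (htt.const_mul 2)
        simpa using h1
      refine tendsto_of_tendsto_of_tendsto_of_le_of_le tendsto_const_nhds h (fun _ => zero_le)
        fun n => ?_
      have h1 := ht0 n
      refine (measure_compl_tube_le (u n) (c := t n / 2) (by positivity)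
        (by linarith [ht1 n])).trans_eq ?_
      rw [ht2]
      congr 1
      field_simp

end USp

end SymplecticConcentration

theorem mainTheorem4 :
    (∀ n : ℕ, IsPrincipalFibration (USp.proj n) (USp.incl n)) ∧
    ∀ u : ∀ n : ℕ, UnitSphere (n + 1),
      (∀ n : ℕ, USp.IsSubmanifoldOfCodim 1 (USp.overEquator (u n))) ∧
      ConcentratesOn (fun n => USp (n + 1)) (fun _ => USp.riemannianDist)
        (fun n => USp.invariantMeasure (n + 1)) (fun n => USp.overEquator (u n)) :=
  ⟨USp.isPrincipalFibration, fun u =>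
    ⟨fun n => USp.isSubmanifoldOfCodim_overEquator (u n), USp.concentratesOn_overEquator u⟩⟩
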